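/- Graphs are finite and undirected, without multiple edges; the guest graph $G$ has no self-loops, the host graph $H$ may have self-loops. A homomorphism $f\colon V(G)\to V(H)$ is locally injective if for every $u\in V(G)$ the restriction of $f$ to the neighbourhood $N_G(u)$ is injective. LIHom is the problem of deciding, for two given graphs $G$ and $H$, whether a locally injective homomorphism from $G$ to $H$ exists. A parameterized problem $Q\subseteq\{0,1\}^*\times\mathbb{N}$ is in XP if there are an algorithm and a computable function $f$ such that the algorithm decides, for every $(I,\kappa)\in\{0,1\}^*\times\mathbb{N}$, whether $(I,\kappa)\in Q$ in time $O\bigl((|I|+2)^{f(\kappa)}\bigr)$. **Theorem.** LIHom is in XP parameterized by the vertex cover number of $G$: the set of all pairs $(\langle G,H\rangle,\kappa)$ such that $\kappa$ is the vertex cover number of $G$ and there is a locally injective homomorphism from $G$ to $H$ is in XP, where $\langle G,H\rangle$ encodes $G$ and $H$ by their numbers of vertices in unary and their adjacency matrices. Moreover, for every constant $k$, LIHom on guest graphs of vertex cover number at most $k$ is polynomial-time solvable: the set of all $\langle G,H\rangle$ such that $G$ has vertex cover number at most $k$ and there is a locally injective homomorphism from $G$ to $H$ is decidable in polynomial time.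 Running times are measured on a random access machine with unit-cost addition, truncated subtraction and indirect addressing. -/

import Mathlib

/-! ## Graphs and locally injective homomorphisms

Guest graphs are loopless (`SimpleGraph`); host graphs may have self-loops. -/

namespace LIHom

/-- An undirected graph without multiple edges in which self-loops are allowed. -/
structure LoopGraph (V : Type*) where
  /-- The adjacency relation; `Adj v v` says that `v` carries a self-loop. -/
  Adj : V → V → Prop
  symm : ∀ u v, Adj u v → Adj v u

/-- `f` is a graph homomorphism from `G` to `H` whose restriction to the neighbourhood
`N_G(u)` of every vertex `u` of `G` is injective. -/
def IsLocInjHom {V W : Type*} (G : SimpleGraph V) (H : LoopGraph W) (f : V → W) : Prop :=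
  (∀ u v, G.Adj u v → H.Adj (f u) (f v)) ∧ ∀ u, Set.InjOn f (G.neighborSet u)

/-- There is a locally injective homomorphism from `G` to `H`. -/
def HasLocInjHom {V W : Type*} (G : SimpleGraph V) (H : LoopGraph W) : Prop :=
  ∃ f : V → W, IsLocInjHom G H f

/-! ## Random access machines

Structured programs for a unit-cost random access machine whose only arithmetic operations
are addition and truncated subtraction. A program names finitely many registers and finitely
many arrays; each register and each array cell holds a natural number, and array cells are
addressed indirectly. Every evaluated expression node and every executed command costs one
step. -/

/-- Expressions. -/
inductive Expr where
  /-- a numeral -/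
  | const (c : ℕ)
  /-- the content of register `r` -/
  | reg (r : ℕ)
  /-- the cell of array `a` at the address given by `e` -/
  | get (a : ℕ) (e : Expr)
  /-- addition -/
  | add (e₁ e₂ : Expr)
  /-- truncated subtraction -/
  | sub (e₁ e₂ : Expr)

/-- Programs. A test succeeds when its expression is nonzero. -/
inductive Prog where
  /-- do nothing -/
  | skip
  /-- put the value of `e` into register `r` -/
  | assign (r : ℕ) (e : Expr)
  /-- put the value of `e` into the cell of array `a` at the address given by `i` -/
  | store (a : ℕ) (i e : Expr)
  /-- sequential composition -/
  | seq (p q : Prog)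
  /-- if `e` is nonzero then `p` else `q` -/
  | ite (e : Expr) (p q : Prog)
  /-- while `e` is nonzero do `p` -/
  | loop (e : Expr) (p : Prog)

/-- The memory of the machine. -/
structure Store where
  /-- the contents of the registers -/
  reg : ℕ → ℕ
  /-- the contents of the arrays: `arr a i` is cell `i` of array `a` -/
  arr : ℕ → ℕ → ℕ

/-- The value of an expression. -/
def Expr.eval (s : Store) : Expr → ℕ
  | .const c => c
  | .reg r => s.reg r
  | .get a e => s.arr a (e.eval s)
  | .add e₁ e₂ => e₁.eval s + e₂.eval s
  | .sub e₁ e₂ => e₁.eval s - e₂.eval s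

/-- The cost of evaluating an expression: its number of nodes. -/
def Expr.cost : Expr → ℕ
  | .const _ => 1
  | .reg _ => 1
  | .get _ e => e.cost + 1
  | .add e₁ e₂ => e₁.cost + e₂.cost + 1
  | .sub e₁ e₂ => e₁.cost + e₂.cost + 1

/-- The store after writing `v` into register `r`. -/
def Store.setReg (s : Store) (r v : ℕ) : Store :=
  { s with reg := Function.update s.reg r v }

/-- The store after writing `v` into cell `i` of array `a`. -/
def Store.setArr (s : Store) (a i v : ℕ) : Store :=
  { s with arr := Function.update s.arr a (Function.update (s.arr a) i v) }

/-- `Exec p s t s'`: started in store `s`, the program `p` halts after exactly `t` steps,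
in store `s'`. -/
inductive Exec : Prog → Store → ℕ → Store → Prop
  | skip (s : Store) : Exec .skip s 1 s
  | assign (r : ℕ) (e : Expr) (s : Store) :
      Exec (.assign r e) s (e.cost + 1) (s.setReg r (e.eval s))
  | store (a : ℕ) (i e : Expr) (s : Store) :
      Exec (.store a i e) s (i.cost + e.cost + 1) (s.setArr a (i.eval s) (e.eval s))
  | seq {p q : Prog} {s s' s'' : Store} {t t' : ℕ} :
      Exec p s t s' → Exec q s' t' s'' → Exec (.seq p q) s (t + t') s''
  | iteTrue {e : Expr} {p q : Prog} {s s' : Store} {t : ℕ} :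
      e.eval s ≠ 0 → Exec p s t s' → Exec (.ite e p q) s (e.cost + t + 1) s'
  | iteFalse {e : Expr} {p q : Prog} {s s' : Store} {t : ℕ} :
      e.eval s = 0 → Exec q s t s' → Exec (.ite e p q) s (e.cost + t + 1) s'
  | loopTrue {e : Expr} {p : Prog} {s s' s'' : Store} {t t' : ℕ} :
      e.eval s ≠ 0 → Exec p s t s' → Exec (.loop e p) s' t' s'' →
        Exec (.loop e p) s (e.cost + t + t' + 1) s''
  | loopFalse {e : Expr} {p : Prog} {s : Store} :
      e.eval s = 0 → Exec (.loop e p) s (e.cost + 1) s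

/-- The initial store on input word `I` and parameter `κ`: the word stands in array `0`,
its length in register `0`, the parameter in register `1`; everything else is zero. -/
def initStore (I : List Bool) (κ : ℕ) : Store where
  reg r := if r = 0 then I.length else if r = 1 then κ else 0
  arr a i := if a = 0 ∧ I[i]? = some true then 1 else 0

/-- On input `(I, κ)` the program `p` halts within `T` steps and its answer, the final content
of register `0`, is `1` if `A` holds and `0` if `A` fails. -/
def Answers (p : Prog) (I : List Bool) (κ : ℕ) (T : ℕ) (A : Prop) : Prop :=
  ∃ t s, Exec p (initStore I κ) t s ∧ t ≤ T ∧ (A → s.reg 0 = 1) ∧ (¬ A → s.reg 0 = 0)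

/-! ## Complexity classes -/

/-- The parameterized problem `Q` is in XP: some algorithm decides on every input `(I, κ)`
whether it belongs to `Q`, in time `O(|I| ^ f(κ))` for a computable function `f`. The base is
`|I| + 2`, so that words of length `0` and `1` are not forced to be treated in constant time. -/
def InXP (Q : Set (List Bool × ℕ)) : Prop :=
  ∃ (p : Prog) (f : ℕ → ℕ) (C : ℕ), Computable f ∧
    ∀ (I : List Bool) (κ : ℕ), Answers p I κ (C * (I.length + 2) ^ f κ) ((I, κ) ∈ Q)

/-- The language `L` is decidable in polynomial time. -/
def InP (L : Set (List Bool)) : Prop :=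
  ∃ (p : Prog) (b : Polynomial ℕ),
    ∀ I : List Bool, Answers p I 0 (b.eval I.length) (I ∈ L)

/-! ## The problem -/

/-- The adjacency matrix of a relation on `Fin n`, row by row. -/
noncomputable def matrixBits {n : ℕ} (R : Fin n → Fin n → Prop) : List Bool :=
  open Classical in List.ofFn fun k : Fin (n * n) => decide (R k.divNat k.modNat)

/-- The word that encodes a guest graph and a host graph: both numbers of vertices in unary,
each closed by `false`, then the two adjacency matrices. -/
noncomputable def encode {n m : ℕ} (G : SimpleGraph (Fin n)) (H : LoopGraph (Fin m)) :
    List Bool :=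
  List.replicate n true ++ [false] ++ (List.replicate m true ++ [false]) ++
    (matrixBits G.Adj ++ matrixBits H.Adj)

/-- The problem of deciding whether `G` has a locally injective homomorphism to `H`,
parameterized by the vertex cover number of `G`: the set of the pairs `(⟨G, H⟩, κ)` such that
`κ` is the vertex cover number of `G` and such a homomorphism exists. -/
def lihomByVC : Set (List Bool × ℕ) :=
  {x | ∃ (n m : ℕ) (G : SimpleGraph (Fin n)) (H : LoopGraph (Fin m)),
    x.1 = encode G H ∧ G.vertexCoverNum = (x.2 : ℕ∞) ∧ HasLocInjHom G H}

/-- The same problem, without a parameter, on guest graphs of vertex cover number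
at most `k`. -/
def lihomVCAtMost (k : ℕ) : Set (List Bool) :=
  {I | ∃ (n m : ℕ) (G : SimpleGraph (Fin n)) (H : LoopGraph (Fin m)),
    I = encode G H ∧ G.vertexCoverNum ≤ (k : ℕ∞) ∧ HasLocInjHom G H}

end LIHom

/-! Guess a vertex cover of `G` with at most `κ` positions together with the images of its vertices.
The other vertices of `G` are independent, so all that matters about such a vertex is its type, the
set `S` of cover positions adjacent to it; there are at most `2 ^ κ` types. Once the images of the
cover are consistent, whether a vertex of nonempty type `S` may go to the host vertex `w` depends
only on `S` and `w` (`Inst.Allowed`). Two vertices outside the cover have a common neighbour exactly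
when their types intersect, so they may share an image exactly when their types are disjoint. Hence
the guess extends to a locally injective homomorphism iff every host vertex can be given a set of
pairwise disjoint allowed types such that each nonempty type is used as often as it has vertices.
Isolated vertices outside the cover only need some host vertex.

This is decided by a scan of the host vertices that remembers how many vertices of each type have
been placed. A state of the scan, with the guess, is a vector of `numDigits κ` numbers below `B =
|I| + 2`, that is, a number below `X = B ^ numDigits κ`. A step lowers no digit and raises the
counter of host vertices, so it leads to a larger number, and reachability can be tabulated in
increasing order. `Inst.Reach.exists_family` and `Inst.Family.reach` identify reachable states with
assignments of types to host vertices; `Inst.Final.exists_isHom` and `Inst.IsHom.exists_final`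
translate between accepted states and homomorphisms.

For the machine, all conditions are written as terms whose only iteration is a sum over the numbers
below `X`. `Term.comp_runs` and `Term.fill_runs` run such terms and tabulate their values in time
polynomial in `X`, that is, `B` to the power of a multiple of `numDigits κ`. This is an XP bound,
and a polynomial one when `κ` is fixed. That `κ` is the exact vertex cover number is checked by also
excluding covers with `κ - 1` positions. -/

/-! ## Total correctness with time bounds -/

namespace LIHom

/-- Started in `s`, the program `p` halts within `T` steps in a store that satisfies `Q`. -/
def Runs (p : Prog) (s : Store) (T : ℕ) (Q : Store → Prop) : Prop :=
  ∃ t s', Exec p s t s' ∧ t ≤ T ∧ Q s'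

@[simp] theorem Store.setReg_reg (s : Store) (r v r' : ℕ) :
    (s.setReg r v).reg r' = if r' = r then v else s.reg r' := by
  simp [Store.setReg, Function.update_apply]

@[simp] theorem Store.setReg_arr (s : Store) (r v : ℕ) : (s.setReg r v).arr = s.arr := rfl

@[simp] theorem Store.setArr_reg (s : Store) (a i v : ℕ) : (s.setArr a i v).reg = s.reg := rfl

theorem Store.setArr_arr (s : Store) (a i v : ℕ) :
    (s.setArr a i v).arr = Function.update s.arr a (Function.update (s.arr a) i v) := rfl

theorem Runs.mono {p : Prog} {s : Store} {T T' : ℕ} {Q Q' : Store → Prop}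
    (h : Runs p s T Q) (hT : T ≤ T') (hQ : ∀ s', Q s' → Q' s') : Runs p s T' Q' := by
  obtain ⟨t, s', he, ht, hq⟩ := h
  exact ⟨t, s', he, ht.trans hT, hQ _ hq⟩

theorem Runs.seq {p q : Prog} {s : Store} {T T' : ℕ} {Q Q' : Store → Prop}
    (hp : Runs p s T Q) (hq : ∀ s', Q s' → Runs q s' T' Q') : Runs (.seq p q) s (T + T') Q' := by
  obtain ⟨t, s', he, ht, h⟩ := hp
  obtain ⟨t', s'', he', ht', h'⟩ := hq _ h
  exact ⟨t + t', s'', he.seq he', by omega, h'⟩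

theorem Runs.assign {r : ℕ} {e : Expr} {s : Store} {Q : Store → Prop}
    (h : Q (s.setReg r (e.eval s))) : Runs (.assign r e) s (e.cost + 1) Q :=
  ⟨_, _, .assign r e s, le_rfl, h⟩

theorem Runs.assign_seq {r : ℕ} {e : Expr} {q : Prog} {s : Store} {T : ℕ} {Q : Store → Prop}
    (h : Runs q (s.setReg r (e.eval s)) T Q) :
    Runs (.seq (.assign r e) q) s (e.cost + 1 + T) Q :=
  Runs.seq (Q := fun s' => s' = s.setReg r (e.eval s)) (.assign rfl) (by rintro _ rfl; exact h)

theorem Runs.store {a : ℕ} {i e : Expr} {s : Store} {Q : Store → Prop}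
    (h : Q (s.setArr a (i.eval s) (e.eval s))) :
    Runs (.store a i e) s (i.cost + e.cost + 1) Q :=
  ⟨_, _, .store a i e s, le_rfl, h⟩

/-- Repeat `p` while register `r`, which is incremented after each round, is below
register `b`. -/
def Prog.forUp (b r : ℕ) (p : Prog) : Prog :=
  .loop (.sub (.reg b) (.reg r)) (.seq p (.assign r (.add (.reg r) (.const 1))))

/-- The overhead of `8` per round is `3 + 1` for the test and `4` for the increment; the final `4`
is the failing test. The invariant must also fix register `b`, so that the number of rounds is known
in advance. -/
theorem Runs.forUp {b r N T : ℕ} {p : Prog} {s : Store} (Inv : ℕ → Store → Prop)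
    (hreg : ∀ i s, Inv i s → s.reg r = i ∧ s.reg b = N)
    (hstep : ∀ i < N, ∀ s, Inv i s →
      Runs p s T fun s' => Inv (i + 1) (s'.setReg r (s'.reg r + 1)))
    (h0 : Inv 0 s) : Runs (.forUp b r p) s (N * (T + 8) + 4) (Inv N) := by
  suffices h : ∀ k i s, i + k = N → Inv i s →
      Runs (.forUp b r p) s (k * (T + 8) + 4) (Inv N) from h N 0 s (by omega) h0
  intro k
  induction k with
  | zero =>
    intro i s hi hs
    obtain ⟨h1, h2⟩ := hreg i s hs
    obtain rfl : i = N := by omega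
    refine ⟨_, s, .loopFalse ?_, ?_, hs⟩
    · simp [Expr.eval, h1, h2]
    · simp [Expr.cost]
  | succ k ih =>
    intro i s hi hs
    obtain ⟨h1, h2⟩ := hreg i s hs
    obtain ⟨t, s', he, ht, hQ⟩ := hstep i (by omega) s hs
    obtain ⟨t', s'', he', ht', hQ'⟩ := ih (i + 1) _ (by omega) hQ
    refine ⟨_, s'', .loopTrue ?_ (he.seq (.assign _ _ _)) he', ?_, hQ'⟩
    · simp [Expr.eval, h1, h2]; omega
    · simp only [Expr.cost]; rw [Nat.succ_mul]; omega

/-! ## Terms with bounded sums -/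

/-- Terms over a memory of arrays and numbered variables, evaluated relative to a size `X`. -/
inductive Term where
  | const (c : ℕ)
  | var (r : ℕ)
  | size
  | get (a : ℕ) (t : Term)
  | add (t₁ t₂ : Term)
  | sub (t₁ t₂ : Term)
  | ite (t t₁ t₂ : Term)
  /-- the sum of `t` over all values of variable `r` below the size -/
  | sum (r : ℕ) (t : Term)
  /-- `t` with variables `r₁`, `r₂` simultaneously set to `t₁`, `t₂` -/
  | let2 (r₁ r₂ : ℕ) (t₁ t₂ t : Term)

/-- The value of a term for size `X`, arrays `A` and variable assignment `ρ`. -/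
def Term.eval (X : ℕ) (A : ℕ → ℕ → ℕ) : Term → (ℕ → ℕ) → ℕ
  | .const c, _ => c
  | .var r, ρ => ρ r
  | .size, _ => X
  | .get a t, ρ => A a (t.eval X A ρ)
  | .add t₁ t₂, ρ => t₁.eval X A ρ + t₂.eval X A ρ
  | .sub t₁ t₂, ρ => t₁.eval X A ρ - t₂.eval X A ρ
  | .ite t t₁ t₂, ρ => if t.eval X A ρ ≠ 0 then t₁.eval X A ρ else t₂.eval X A ρ
  | .sum r t, ρ => ∑ i ∈ Finset.range X, t.eval X A (Function.update ρ r i)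
  | .let2 r₁ r₂ t₁ t₂ t, ρ =>
    t.eval X A (Function.update (Function.update ρ r₁ (t₁.eval X A ρ)) r₂ (t₂.eval X A ρ))

/-- The first register above those that hold the size and the variables of a term. -/
def Term.bd : Term → ℕ
  | .const _ => 1
  | .var r => r + 2
  | .size => 1
  | .get _ t => t.bd
  | .add t₁ t₂ => max t₁.bd t₂.bd
  | .sub t₁ t₂ => max t₁.bd t₂.bd
  | .ite t t₁ t₂ => max t.bd (max t₁.bd t₂.bd)
  | .sum r t => max (r + 2) t.bd
  | .let2 r₁ r₂ t₁ t₂ t => max (max (r₁ + 2) (r₂ + 2)) (max t.bd (max t₁.bd t₂.bd))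

/-- A program that puts the value of a term into register `d`, using only registers from `d`
on as temporary storage. The size is in register `0` and variable `r` in register `r + 1`. -/
def Term.comp (d : ℕ) : Term → Prog
  | .const c => .assign d (.const c)
  | .var r => .assign d (.reg (r + 1))
  | .size => .assign d (.reg 0)
  | .get a t => .seq (t.comp d) (.assign d (.get a (.reg d)))
  | .add t₁ t₂ => .seq (t₁.comp d) (.seq (t₂.comp (d + 1))
      (.assign d (.add (.reg d) (.reg (d + 1)))))
  | .sub t₁ t₂ => .seq (t₁.comp d) (.seq (t₂.comp (d + 1))
      (.assign d (.sub (.reg d) (.reg (d + 1)))))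
  | .ite t t₁ t₂ => .seq (t.comp d) (.ite (.reg d) (t₁.comp d) (t₂.comp d))
  | .sum r t => .seq (.assign d (.const 0)) (.seq (.assign (d + 1) (.reg (r + 1)))
      (.seq (.assign (r + 1) (.const 0))
      (.seq (.forUp 0 (r + 1) (.seq (t.comp (d + 2))
        (.assign d (.add (.reg d) (.reg (d + 2))))))
      (.assign (r + 1) (.reg (d + 1))))))
  | .let2 r₁ r₂ t₁ t₂ t => .seq (t₁.comp d) (.seq (t₂.comp (d + 1))
      (.seq (.assign (d + 2) (.reg (r₁ + 1))) (.seq (.assign (d + 3) (.reg (r₂ + 1)))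
      (.seq (.assign (r₁ + 1) (.reg d)) (.seq (.assign (r₂ + 1) (.reg (d + 1)))
      (.seq (t.comp (d + 4))
      (.seq (.assign (r₂ + 1) (.reg (d + 3))) (.seq (.assign (r₁ + 1) (.reg (d + 2)))
      (.assign d (.reg (d + 4)))))))))))

/-- A bound on the running time of the compiled term. -/
def Term.time (X : ℕ) : Term → ℕ
  | .const _ => 2
  | .var _ => 2
  | .size => 2
  | .get _ t => t.time X + 3
  | .add t₁ t₂ => t₁.time X + (t₂.time X + 4)
  | .sub t₁ t₂ => t₁.time X + (t₂.time X + 4)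
  | .ite t t₁ t₂ => t.time X + (t₁.time X + t₂.time X + 2)
  | .sum _ t => 2 + (2 + (2 + ((X * (t.time X + 4 + 8) + 4) + 2)))
  | .let2 _ _ t₁ t₂ t => t₁.time X + (t₂.time X + (8 + (t.time X + 6)))

/-- The store holds size `X`, variables `ρ` (those kept below register `d`) and arrays `A`. -/
def Holds (d X : ℕ) (A : ℕ → ℕ → ℕ) (ρ : ℕ → ℕ) (s : Store) : Prop :=
  s.reg 0 = X ∧ (∀ i, i + 1 < d → s.reg (i + 1) = ρ i) ∧ s.arr = A

/-- The two stores agree below register `d` and on all arrays. -/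
def Same (d : ℕ) (s s' : Store) : Prop :=
  (∀ i < d, s'.reg i = s.reg i) ∧ s'.arr = s.arr

theorem Same.holds {d X : ℕ} {A : ℕ → ℕ → ℕ} {ρ : ℕ → ℕ} {s s' : Store} (hd : 0 < d)
    (h : Same d s s') (hs : Holds d X A ρ s) : Holds d X A ρ s' :=
  ⟨(h.1 0 hd).trans hs.1, fun i hi => (h.1 _ hi).trans (hs.2.1 i hi), h.2.trans hs.2.2⟩

theorem Same.trans {d : ℕ} {s s' s'' : Store} (h : Same d s s') (h' : Same d s' s'') :
    Same d s s'' :=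
  ⟨fun i hi => (h'.1 i hi).trans (h.1 i hi), h'.2.trans h.2⟩

theorem Same.mono {d d' : ℕ} {s s' : Store} (h : Same d s s') (hd : d' ≤ d) : Same d' s s' :=
  ⟨fun i hi => h.1 i (hi.trans_le hd), h.2⟩

theorem Same.setReg {d r v : ℕ} {s s' : Store} (h : Same d s s') (hr : d ≤ r) :
    Same d s (s'.setReg r v) :=
  ⟨fun i hi => by simp [h.1 i hi, (hi.trans_le hr).ne], h.2⟩

theorem Holds.mono {d d' X : ℕ} {A : ℕ → ℕ → ℕ} {ρ : ℕ → ℕ} {s : Store}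
    (h : Holds d X A ρ s) (hd : d' ≤ d) : Holds d' X A ρ s :=
  ⟨h.1, fun i hi => h.2.1 i (hi.trans_le hd), h.2.2⟩

theorem Holds.setReg {d X r v : ℕ} {A : ℕ → ℕ → ℕ} {ρ : ℕ → ℕ} {s : Store}
    (h : Holds d X A ρ s) : Holds d X A (Function.update ρ r v) (s.setReg (r + 1) v) := by
  refine ⟨by simp [h.1], fun i hi => ?_, by simp [h.2.2]⟩
  by_cases hir : i = r
  · simp [hir]
  · simp [hir, h.2.1 i hi]

theorem Term.bd_pos (t : Term) : 0 < t.bd := by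
  induction t <;> simp_all [Term.bd]

/-- Intermediate results live in registers from `d` on, so a subterm compiled at a higher `d` cannot
disturb them. For the induction it is essential that all registers below `d` come back unchanged:
`sum` and `let2` overwrite variables and have to restore them. -/
theorem Term.comp_runs {X : ℕ} {A : ℕ → ℕ → ℕ} (t : Term) :
    ∀ {d : ℕ} {ρ : ℕ → ℕ} {s : Store}, t.bd ≤ d → Holds t.bd X A ρ s →
      Runs (t.comp d) s (t.time X) fun s' => Same d s s' ∧ s'.reg d = t.eval X A ρ := by
  induction t with
  | const c =>
    intro d ρ s hd hs
    exact .assign ⟨⟨fun i hi => by simp [hi.ne], rfl⟩, by simp [Expr.eval, Term.eval]⟩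
  | var r =>
    intro d ρ s hd hs
    simp only [Term.bd] at hd
    exact .assign ⟨⟨fun i hi => by simp [hi.ne], rfl⟩,
      by simp [Expr.eval, Term.eval, hs.2.1 r (by simp [Term.bd])]⟩
  | size =>
    intro d ρ s hd hs
    exact .assign ⟨⟨fun i hi => by simp [hi.ne], rfl⟩, by simp [Expr.eval, Term.eval, hs.1]⟩
  | get a t ih =>
    intro d ρ s hd hs
    refine .seq (ih hd hs) fun s' ⟨h, hv⟩ => .assign ⟨h.setReg le_rfl, ?_⟩
    simp [Expr.eval, Term.eval, hv, h.2, hs.2.2]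
  | add t₁ t₂ ih₁ ih₂ =>
    intro d ρ s hd hs
    simp only [Term.bd, max_le_iff] at hd
    refine .seq (ih₁ hd.1 (hs.mono (by simp [Term.bd]))) fun s' ⟨h, hv⟩ => ?_
    have hs' := (h.mono hd.2).holds t₂.bd_pos (hs.mono (by simp [Term.bd]))
    refine .seq (ih₂ (hd.2.trans d.le_succ) hs') fun s'' ⟨h', hv'⟩ => .assign
      ⟨(h.trans (h'.mono d.le_succ)).setReg le_rfl, ?_⟩
    simp [Expr.eval, Term.eval, hv', h'.1 d (by omega), hv]
  | sub t₁ t₂ ih₁ ih₂ =>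
    intro d ρ s hd hs
    simp only [Term.bd, max_le_iff] at hd
    refine .seq (ih₁ hd.1 (hs.mono (by simp [Term.bd]))) fun s' ⟨h, hv⟩ => ?_
    have hs' := (h.mono hd.2).holds t₂.bd_pos (hs.mono (by simp [Term.bd]))
    refine .seq (ih₂ (hd.2.trans d.le_succ) hs') fun s'' ⟨h', hv'⟩ => .assign
      ⟨(h.trans (h'.mono d.le_succ)).setReg le_rfl, ?_⟩
    simp [Expr.eval, Term.eval, hv', h'.1 d (by omega), hv]
  | ite t t₁ t₂ ih ih₁ ih₂ =>
    intro d ρ s hd hs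
    simp only [Term.bd, max_le_iff] at hd
    refine .seq (ih hd.1 (hs.mono (by simp [Term.bd]))) fun s' ⟨h, hv⟩ => ?_
    by_cases hc : t.eval X A ρ = 0
    · obtain ⟨k, s'', he, hk, h', hv'⟩ := ih₂ hd.2.2
        ((h.mono hd.2.2).holds t₂.bd_pos (hs.mono (by simp [Term.bd])))
      refine ⟨_, s'', .iteFalse (by simp [Expr.eval, hv, hc]) he, ?_, h.trans h', ?_⟩
      · simp [Expr.cost]; omega
      · simp [Term.eval, hc, hv']
    · obtain ⟨k, s'', he, hk, h', hv'⟩ := ih₁ hd.2.1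
        ((h.mono hd.2.1).holds t₁.bd_pos (hs.mono (by simp [Term.bd])))
      refine ⟨_, s'', .iteTrue (by simp [Expr.eval, hv, hc]) he, ?_, h.trans h', ?_⟩
      · simp [Expr.cost]; omega
      · simp [Term.eval, hc, hv']
  | sum r t ih =>
    intro d ρ s hd hs
    simp only [Term.bd, max_le_iff] at hd
    -- Register `d` collects the partial sum, while `d + 1` keeps the old value of the summation
    -- variable, whose register serves as loop counter.
    refine .assign_seq (.assign_seq (.assign_seq (.seq (.forUp (fun i s' =>
      s'.reg (r + 1) = i ∧ (∀ j < d, j ≠ r + 1 → s'.reg j = s.reg j) ∧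
      s'.reg (d + 1) = s.reg (r + 1) ∧ s'.arr = s.arr ∧
      s'.reg d = ∑ k ∈ Finset.range i, t.eval X A (Function.update ρ r k)) ?_ ?_ ?_)
      fun s' hs' => .assign ⟨⟨fun i hi => ?_, ?_⟩, ?_⟩)))
    · rintro i s' ⟨h1, h2, -⟩
      exact ⟨h1, (h2 0 (by omega) (by omega)).trans hs.1⟩
    · rintro i hi s' ⟨h1, h2, h3, h4, h5⟩
      have hs' : Holds t.bd X A (Function.update ρ r i) s' := by
        refine ⟨(h2 0 (by omega) (by omega)).trans hs.1, fun j hj => ?_, h4.trans hs.2.2⟩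
        by_cases hjr : j = r
        · simp [hjr, h1]
        · simp [hjr, h2 (j + 1) (by omega) (by omega), hs.2.1 j (by simp [Term.bd]; omega)]
      refine .seq (ih (d := d + 2) (by omega) hs') fun s'' ⟨h, hv⟩ => .assign ⟨?_, ?_, ?_, ?_, ?_⟩
      · simp [show r + 1 ≠ d by omega, h.1 (r + 1) (by omega), h1]
      · intro j hj hjr
        simp [hjr, hj.ne, h.1 j (by omega), h2 j hj hjr]
      · simp [show d ≠ r by omega, h.1 (d + 1) (by omega), h3]
      · simp [h.2, h4]
      · simp [show d ≠ r + 1 by omega, Expr.eval, h.1 d (by omega), h5, hv,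
          Finset.sum_range_succ]
    · refine ⟨by simp [Expr.eval], fun j hj hjr => ?_, ?_, rfl, ?_⟩
      · simp [hjr, hj.ne, show j ≠ d + 1 by omega]
      · simp [show d ≠ r by omega, Expr.eval, show r + 1 ≠ d by omega]
      · simp [show d ≠ r + 1 by omega, Expr.eval]
    · obtain ⟨h1, h2, h3, h4, h5⟩ := hs'
      by_cases hir : i = r + 1
      · simp [Expr.eval, hir, h3]
      · simp [Expr.eval, hir, h2 i hi hir]
    · exact hs'.2.2.2.1
    · simp [show d ≠ r + 1 by omega, hs'.2.2.2.2, Term.eval]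
  | let2 r₁ r₂ t₁ t₂ t ih₁ ih₂ ih =>
    intro d ρ s hd hs
    simp only [Term.bd, max_le_iff] at hd
    obtain ⟨⟨hr₁, hr₂⟩, ht, ht₁, ht₂⟩ := hd
    refine Runs.mono (T := t₁.time X + (t₂.time X + (2 + (2 + (2 + (2 + (t.time X +
      (2 + (2 + 2))))))))) ?_ (by simp only [Term.time]; omega) fun _ h => h
    refine .seq (ih₁ ht₁ (hs.mono (by simp [Term.bd]))) fun s' ⟨h, hv⟩ => ?_
    have hs' := (h.mono ht₂).holds t₂.bd_pos (hs.mono (by simp [Term.bd]))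
    refine .seq (ih₂ (ht₂.trans d.le_succ) hs') fun s'' ⟨h', hv'⟩ => ?_
    have h'' := h.trans (h'.mono d.le_succ)
    have hs'' := (h''.mono ht).holds t.bd_pos (hs.mono (by simp [Term.bd]))
    -- Four registers are occupied, by the two new values and the two old ones; hence the body is
    -- compiled at `d + 4`.
    refine .assign_seq (.assign_seq (.assign_seq (.assign_seq (.seq
      (ih (ρ := Function.update (Function.update ρ r₁ (t₁.eval X A ρ)) r₂ (t₂.eval X A ρ))
        (d := d + 4) (by omega) ⟨?_, ?_, ?_⟩) fun u ⟨hu, hw⟩ => .assign_seq (.assign_seq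
      (.assign ⟨⟨fun i hi => ?_, ?_⟩, ?_⟩))))))
    · simp [hs''.1]
    · intro i hi
      have e1 : r₂ + 1 ≠ d + 2 := by omega
      have e2 : r₁ + 1 ≠ d + 2 := by omega
      simp only [Store.setReg_reg, Expr.eval, Function.update_apply, Nat.add_right_cancel_iff]
      by_cases h2 : i = r₂
      · subst h2
        simp [hv', show d ≠ r₁ by omega]
      · by_cases h1 : i = r₁
        · subst h1
          simp [h2, h'.1 d (by omega), hv]
        · simp [h1, h2, show i ≠ d + 1 by omega, show i ≠ d + 2 by omega, hs''.2.1 i hi]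
    · simp [hs''.2.2]
    -- Both old values were saved before either variable was overwritten, so the restoration is
    -- correct even if `r₁ = r₂`.
    · have q2 := hu.1 (d + 2) (by omega)
      have q3 := hu.1 (d + 3) (by omega)
      have q := hu.1 i (by omega)
      simp only [Store.setReg_reg, Expr.eval] at q q2 q3 ⊢
      have := h''.1 i hi
      have := h''.1 (r₁ + 1) (by omega)
      have := h''.1 (r₂ + 1) (by omega)
      grind
    · simp [hu.2, h''.2]
    · simp [Expr.eval, hw, Term.eval, show d + 3 ≠ r₁ by omega, show d + 3 ≠ r₂ by omega]

/-- Put the value of `t` into variable `r`. -/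
def Term.assign (d r : ℕ) (t : Term) : Prog :=
  .seq (t.comp d) (.assign (r + 1) (.reg d))

/-- For all values of variable `r` below the size, in increasing order, put the value of `t`
into cell `r` of array `a`. -/
def Term.fill (d a r : ℕ) (t : Term) : Prog :=
  .seq (.assign (r + 1) (.const 0))
    (.forUp 0 (r + 1) (.seq (t.comp d) (.store a (.reg (r + 1)) (.reg d))))

theorem Term.assign_runs {X d r : ℕ} {A : ℕ → ℕ → ℕ} {ρ : ℕ → ℕ} {s : Store} {t : Term}
    (ht : t.bd ≤ d) (hs : Holds d X A ρ s) :
    Runs (t.assign d r) s (t.time X + 2) (Holds d X A (Function.update ρ r (t.eval X A ρ))) := by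
  refine .seq (t.comp_runs ht (hs.mono ht)) fun s' ⟨h, hv⟩ => .assign ?_
  simpa only [Expr.eval, hv] using (h.holds (t.bd_pos.trans_le ht) hs).setReg

/-- Tabulation by course-of-values recursion: `t` may read the array that is being filled, provided
that its value at `i` is already determined by the cells below `i`. Nothing is claimed about cells
from `X` on. -/
theorem Term.fill_runs {X d a r : ℕ} {A : ℕ → ℕ → ℕ} {ρ : ℕ → ℕ} {s : Store} {t : Term}
    (ht : t.bd ≤ d) (hr : r + 1 < d) (hs : Holds d X A ρ s) (g : ℕ → ℕ)
    (hg : ∀ i < X, ∀ row : ℕ → ℕ, (∀ j < i, row j = g j) →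
      t.eval X (Function.update A a row) (Function.update ρ r i) = g i) :
    Runs (t.fill d a r) s (2 + (X * (t.time X + 3 + 8) + 4)) fun s' =>
      ∃ row, (∀ i < X, row i = g i) ∧
        Holds d X (Function.update A a row) (Function.update ρ r X) s' := by
  refine .assign_seq (Runs.mono (.forUp (fun i s' => ∃ row, (∀ j < i, row j = g j) ∧
    s'.reg (r + 1) = i ∧ Holds d X (Function.update A a row) (Function.update ρ r i) s')
    ?_ ?_ ?_) le_rfl ?_)
  · rintro i s' ⟨row, -, h1, h2⟩
    exact ⟨h1, h2.1⟩
  · rintro i hi s' ⟨row, hrow, h1, h2⟩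
    refine .seq (t.comp_runs ht (h2.mono ht)) fun s'' ⟨h, hv⟩ => .store
      ⟨Function.update row i (g i), fun j hj => ?_, ?_, ?_⟩
    · by_cases hji : j = i
      · simp [hji]
      · simp [hji, hrow j (by omega)]
    · simp [h.1 (r + 1) hr, h1]
    · have h3 := h.holds (by omega) h2
      rw [hg i hi row hrow] at hv
      have h4 : Holds d X (Function.update A a (Function.update row i (g i)))
          (Function.update ρ r i) (s''.setArr a (s''.reg (r + 1)) (s''.reg d)) := by
        refine ⟨h3.1, h3.2.1, ?_⟩
        simp [Store.setArr_arr, h3.2.2, hv, h.1 (r + 1) hr, h1]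
      have h5 := h4.setReg (r := r) (v := i + 1)
      rw [Function.update_idem] at h5
      simpa [Expr.eval, h.1 (r + 1) hr, h1] using h5
  -- Before the first round the row is whatever the array contains.
  · refine ⟨A a, by simp, by simp [Expr.eval], ?_⟩
    simpa [Expr.eval] using hs.setReg (r := r) (v := 0)
  · rintro s' ⟨row, h1, -, h2⟩
    exact ⟨row, h1, h2⟩

/-! ### Polynomial time bounds for terms -/

/-- `f` is bounded by a polynomial. -/
def PolyBounded (f : ℕ → ℕ) : Prop :=
  ∃ C D, ∀ x, f x ≤ C * (x + 1) ^ D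

theorem PolyBounded.const (c : ℕ) : PolyBounded fun _ => c := ⟨c, 0, by simp⟩

theorem PolyBounded.id : PolyBounded fun x => x := ⟨1, 1, by simp⟩

theorem PolyBounded.add {f g : ℕ → ℕ} (hf : PolyBounded f) (hg : PolyBounded g) :
    PolyBounded fun x => f x + g x := by
  obtain ⟨C, D, h⟩ := hf
  obtain ⟨C', D', h'⟩ := hg
  refine ⟨C + C', D + D', fun x => ?_⟩
  rw [add_mul]
  refine add_le_add ((h x).trans ?_) ((h' x).trans ?_) <;>
    exact Nat.mul_le_mul_left _ (Nat.pow_le_pow_right (by omega) (by omega))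

theorem PolyBounded.mul {f g : ℕ → ℕ} (hf : PolyBounded f) (hg : PolyBounded g) :
    PolyBounded fun x => f x * g x := by
  obtain ⟨C, D, h⟩ := hf
  obtain ⟨C', D', h'⟩ := hg
  refine ⟨C * C', D + D', fun x => (Nat.mul_le_mul (h x) (h' x)).trans_eq ?_⟩
  ring

theorem Term.time_polyBounded (t : Term) : PolyBounded fun X => t.time X := by
  induction t <;> simp only [Term.time] <;>
    repeat' first
      | assumption
      | exact .const _
      | exact .id
      | apply PolyBounded.add
      | apply PolyBounded.mul

/-! ## The size bound -/

/-- The number of base-`|I| + 2` digits of the numbers that the algorithm searches. -/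
def numDigits (κ : ℕ) : ℕ := 2 ^ κ + 1 + (κ + κ)

/-- Put `|I| + 2` into register `2`, `2 ^ κ` into register `3` and
`(|I| + 2) ^ numDigits κ` into register `0`. -/
def setup : Prog :=
  .seq (.assign 2 (.add (.reg 0) (.const 2)))
  (.seq (.assign 3 (.const 1))
  (.seq (.assign 5 (.const 0))
  (.seq (.forUp 1 5 (.assign 3 (.add (.reg 3) (.reg 3))))
  (.seq (.assign 4 (.add (.add (.reg 3) (.const 1)) (.add (.reg 1) (.reg 1))))
  (.seq (.assign 0 (.const 1))
  (.seq (.assign 5 (.const 0))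
  (.forUp 4 5
    (.seq (.assign 7 (.const 0))
    (.seq (.assign 6 (.const 0))
    (.seq (.forUp 2 6 (.assign 7 (.add (.reg 7) (.reg 0))))
    (.assign 0 (.reg 7))))))))))))

/-- The machine cannot multiply: `2 ^ κ` arises from `κ` doublings, and each factor `B = |I| + 2`
costs a loop of `B` additions into register `7`. -/
theorem setup_runs (I : List Bool) (κ : ℕ) :
    Runs setup (initStore I κ)
      (30 + κ * 12 + numDigits κ * ((I.length + 2) * 12 + 18)) fun s =>
      s.reg 0 = (I.length + 2) ^ numDigits κ ∧ s.reg 1 = κ ∧ s.reg 2 = I.length + 2 ∧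
        s.reg 3 = 2 ^ κ ∧ s.arr = (initStore I κ).arr := by
  refine Runs.mono (T := 4 + (2 + (2 + ((κ * (4 + 8) + 4) + (8 + (2 + (2 +
    (numDigits κ * ((2 + (2 + (((I.length + 2) * (4 + 8) + 4) + 2))) + 8) + 4))))))))
    ?_ (by
      generalize numDigits κ = L
      generalize I.length + 2 = B
      have : L * (2 + (2 + (B * (4 + 8) + 4 + 2)) + 8) = L * (B * 12 + 18) := by ring
      omega) fun _ h => h
  refine .assign_seq (.assign_seq (.assign_seq (.seq (.forUp (fun i s =>
    s.reg 5 = i ∧ s.reg 1 = κ ∧ s.reg 2 = I.length + 2 ∧ s.reg 3 = 2 ^ i ∧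
    s.arr = (initStore I κ).arr) ?_ ?_ ?_) fun s ⟨h5, h1, h2, h3, h⟩ => .assign_seq (.assign_seq
      (.assign_seq (Runs.mono (.forUp (fun i s =>
    s.reg 5 = i ∧ s.reg 4 = numDigits κ ∧ s.reg 1 = κ ∧ s.reg 2 = I.length + 2 ∧ s.reg 3 = 2 ^ κ ∧
    s.reg 0 = (I.length + 2) ^ i ∧ s.arr = (initStore I κ).arr) ?_ ?_ ?_) le_rfl ?_))))))
  · rintro i s ⟨h5, h1, -⟩
    exact ⟨h5, h1⟩
  · rintro i - s ⟨h5, h1, h2, h3, h⟩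
    refine .assign ?_
    simp [h5, h1, h2, h3, h, Expr.eval, pow_succ, mul_two]
  · simp [initStore, Expr.eval]
  · rintro i s ⟨h5, h4, -⟩
    exact ⟨h5, h4⟩
  · rintro i - s ⟨h5, h4, h1, h2, h3, h0, h⟩
    refine .assign_seq (.assign_seq (.seq (.forUp (fun j s' =>
      s'.reg 6 = j ∧ s'.reg 7 = j * (I.length + 2) ^ i ∧ s'.reg 5 = i ∧ s'.reg 4 = numDigits κ ∧
      s'.reg 1 = κ ∧ s'.reg 2 = I.length + 2 ∧ s'.reg 3 = 2 ^ κ ∧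
      s'.reg 0 = (I.length + 2) ^ i ∧ s'.arr = (initStore I κ).arr) ?_ ?_ ?_) ?_))
    · rintro j s' ⟨h6, -, -, -, -, h2, -⟩
      exact ⟨h6, h2⟩
    · rintro j - s' ⟨h6, h7, h5, h4, h1, h2, h3, h0, h⟩
      refine .assign ?_
      simp [h5, h4, h1, h2, h3, h, h0, h6, h7, Expr.eval, Nat.succ_mul]
    · simp [h5, h4, h1, h2, h3, h, h0, Expr.eval]
    · rintro s' ⟨h6, h7, h5, h4, h1, h2, h3, h0, h⟩
      refine .assign ?_
      simp [h5, h4, h1, h2, h3, h, h7, Expr.eval, pow_succ, mul_comm]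
  · simp [h1, h2, h3, h, Expr.eval, numDigits]
  · rintro s ⟨-, -, h1, h2, h3, h0, h⟩
    exact ⟨h0, h1, h2, h3, h⟩

/-! ## Certificates

A number below `B ^ numDigits κ` is read as a vector of base-`B` digits. Its first `2 ^ κ` digits
count, for every set `S` of positions of the vertex cover, how many vertices of type `S` have been
placed; the next digit is the number of host vertices that have been considered; the last
`2 * κ` digits are the vertices of the cover and their images. -/

/-- The `i`-th base-`B` digit of `z`. -/
def dig (B z i : ℕ) : ℕ := z / B ^ i % B

/-- A guest graph on the numbers below `n` and a host graph on the numbers below `m`, with the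
parameter `κ` and the base `B`. -/
structure Inst where
  κ : ℕ
  B : ℕ
  n : ℕ
  m : ℕ
  G : ℕ → ℕ → Prop
  H : ℕ → ℕ → Prop

namespace Inst

variable (P : Inst)

/-- Position `i` of the vertex cover; a value of at least `n` means that it is not used. -/
def C (z i : ℕ) : ℕ := dig P.B z (2 ^ P.κ + 1 + i)

/-- The image of position `i` of the vertex cover. -/
def F (z i : ℕ) : ℕ := dig P.B z (2 ^ P.κ + 1 + P.κ + i)

/-- The number of host vertices that have been considered. -/
def W (z : ℕ) : ℕ := dig P.B z (2 ^ P.κ)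

/-- The first `j` positions form a vertex cover. -/
def Covers (j z : ℕ) : Prop :=
  ∀ u < P.n, ∀ v < P.n, P.G u v → ∃ i < j, u = P.C z i ∨ v = P.C z i

def InCover (z v : ℕ) : Prop := ∃ i < P.κ, P.C z i = v

/-- The images of the cover form a partial locally injective homomorphism. -/
def Consistent (z : ℕ) : Prop :=
  ∀ i < P.κ, (P.C z i < P.n → P.F z i < P.m) ∧ ∀ j < P.κ,
    (P.C z i = P.C z j → P.F z i = P.F z j) ∧
    (P.G (P.C z i) (P.C z j) → P.H (P.F z i) (P.F z j)) ∧
    ∀ v < P.n, P.G v (P.C z i) → P.G v (P.C z j) → P.F z i = P.F z j → P.C z i = P.C z j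

/-- A vertex of type `S` may be mapped to the host vertex `w`. -/
def Allowed (z S w : ℕ) : Prop :=
  S ≠ 0 ∧ ∀ i < P.κ, S.testBit i = true →
    P.H (P.F z i) w ∧ ∀ j < P.κ, P.G (P.C z i) (P.C z j) → P.F z j ≠ w

def Disj (S S' : ℕ) : Prop := ∀ i < P.κ, ¬ (S.testBit i = true ∧ S'.testBit i = true)

/-- The vertex `v` lies outside the cover and `S` is the set of positions of its neighbours. -/
def IsType (z S v : ℕ) : Prop :=
  ¬ P.InCover z v ∧ ∀ i < P.κ, (S.testBit i = true ↔ P.G (P.C z i) v)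

def Init (z : ℕ) : Prop := P.W z = 0 ∧ ∀ S < 2 ^ P.κ, dig P.B z S = 0

/-- From `z'` to `z` one more host vertex is considered, and at most one vertex of every type is
mapped to it. -/
def Step (z' z : ℕ) : Prop :=
  P.W z = P.W z' + 1 ∧
  (∀ i < P.κ + P.κ, dig P.B z (2 ^ P.κ + 1 + i) = dig P.B z' (2 ^ P.κ + 1 + i)) ∧
  ∀ S < 2 ^ P.κ, dig P.B z S = dig P.B z' S ∨
    dig P.B z S = dig P.B z' S + 1 ∧ P.Allowed z S (P.W z') ∧
      ∀ S' < 2 ^ P.κ, S' ≠ S → dig P.B z S' = dig P.B z' S' + 1 → P.Disj S S'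

/-- The certificates that are reachable from an initial one. -/
inductive Reach : ℕ → Prop
  | init {z : ℕ} : P.Init z → Reach z
  | step {z' z : ℕ} : z' < z → Reach z' → P.Step z' z → Reach z

open Classical in
/-- The number of vertices of type `S`. -/
noncomputable def count (z S : ℕ) : ℕ := ((Finset.range P.n).filter (P.IsType z S)).card

def Final (z : ℕ) : Prop :=
  P.Covers P.κ z ∧ P.Consistent z ∧ P.W z = P.m ∧ (P.n = 0 ∨ 0 < P.m) ∧
    (∀ S < 2 ^ P.κ, S ≠ 0 → dig P.B z S = P.count z S) ∧ P.Reach z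

theorem reach_iff (z : ℕ) :
    P.Reach z ↔ P.Init z ∨ ∃ z' < z, P.Reach z' ∧ P.Step z' z := by
  constructor
  · rintro (h | ⟨h1, h2, h3⟩)
    · exact .inl h
    · exact .inr ⟨_, h1, h2, h3⟩
  · rintro (h | ⟨z', h1, h2, h3⟩)
    · exact .init h
    · exact .step h1 h2 h3

end Inst

/-! ### Digit vectors and sets of positions as numbers -/

theorem dig_lt {B : ℕ} (hB : 0 < B) (z i : ℕ) : dig B z i < B := Nat.mod_lt _ hB

theorem dig_succ (B z i : ℕ) : dig B z (i + 1) = dig B (z / B) i := by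
  simp [dig, pow_succ', Nat.div_div_eq_div_mul]

theorem exists_dig {B : ℕ} (hB : 0 < B) (L : ℕ) :
    ∀ a : ℕ → ℕ, (∀ i < L, a i < B) → ∃ z < B ^ L, ∀ i < L, dig B z i = a i := by
  induction L with
  | zero => exact fun a _ => ⟨0, by simp⟩
  | succ L ih =>
    intro a ha
    obtain ⟨z, hz, h⟩ := ih (fun i => a (i + 1)) fun i hi => ha _ (by omega)
    have h0 := ha 0 (by omega)
    refine ⟨a 0 + B * z, ?_, fun i hi => ?_⟩
    · calc a 0 + B * z < B * (z + 1) := by rw [mul_add]; omega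
        _ ≤ B * B ^ L := Nat.mul_le_mul_left _ hz
        _ = B ^ (L + 1) := (pow_succ' _ _).symm
    · cases i with
      | zero => simp [dig, Nat.mod_eq_of_lt h0]
      | succ i =>
        rw [dig_succ, Nat.add_mul_div_left _ _ hB, Nat.div_eq_of_lt h0, zero_add]
        exact h i (by omega)

/-- Quotient and remainder by `B` are compared separately. The bound is needed for `z'` alone, since
further digits of `z` only make it larger. This is what orders the certificates along the steps. -/
theorem le_of_dig_le {B : ℕ} (L : ℕ) : ∀ {z z' : ℕ}, z' < B ^ L →
    (∀ i < L, dig B z' i ≤ dig B z i) → z' ≤ z := by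
  induction L with
  | zero => intro z z' hz; simp at hz; omega
  | succ L ih =>
    intro z z' hz h
    have h0 : z' % B ≤ z % B := by simpa [dig] using h 0 (by omega)
    have h1 : z' / B ≤ z / B := ih
      (Nat.div_lt_of_lt_mul (by rwa [← pow_succ'])) fun i hi => by
        simpa only [dig_succ] using h (i + 1) (by omega)
    calc z' = B * (z' / B) + z' % B := (Nat.div_add_mod _ _).symm
      _ ≤ B * (z / B) + z % B := add_le_add (Nat.mul_le_mul_left _ h1) h0
      _ = z := Nat.div_add_mod _ _

/-- Types are sets of positions, coded as numbers below `2 ^ κ`; every set of positions has a code,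
and `eq_of_testBit_iff` makes it unique. -/
theorem exists_testBit_iff (κ : ℕ) (p : ℕ → Prop) :
    ∃ S < 2 ^ κ, ∀ i < κ, (S.testBit i = true ↔ p i) := by
  classical
  refine ⟨Nat.ofBits fun i : Fin κ => decide (p i), Nat.ofBits_lt_two_pow _, fun i hi => ?_⟩
  rw [Nat.testBit_ofBits_lt _ _ hi]
  simp

theorem eq_of_testBit_iff {κ S S' : ℕ} (hS : S < 2 ^ κ) (hS' : S' < 2 ^ κ)
    (h : ∀ i < κ, (S.testBit i = true ↔ S'.testBit i = true)) : S = S' := by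
  refine Nat.eq_of_testBit_eq fun i => ?_
  by_cases hi : i < κ
  · exact Bool.eq_iff_iff.2 (h i hi)
  · have := Nat.pow_le_pow_right (n := 2) (by omega) (not_lt.1 hi)
    rw [Nat.testBit_lt_two_pow (hS.trans_le this), Nat.testBit_lt_two_pow (hS'.trans_le this)]

theorem exists_testBit {κ S : ℕ} (hS : S < 2 ^ κ) (h0 : S ≠ 0) : ∃ i < κ, S.testBit i = true := by
  by_contra! h
  exact h0 (eq_of_testBit_iff hS (by positivity) fun i hi => by simpa using h i hi)

open Classical in
theorem card_filter_range_succ (p : ℕ → Prop) (n : ℕ) :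
    ((Finset.range (n + 1)).filter p).card =
      ((Finset.range n).filter p).card + if p n then 1 else 0 := by
  rw [Finset.range_add_one, Finset.filter_insert]
  split_ifs
  · rw [Finset.card_insert_of_notMem (by simp)]
  · simp

/-! ### Reachable certificates and assignments of types to host vertices -/

namespace Inst

variable (P : Inst)

open Classical in
/-- Host vertex `w` receives one vertex of each type `S` with `Q w S`, and the digits of `z`
count them. -/
def Family (z : ℕ) (Q : ℕ → ℕ → Prop) : Prop :=
  (∀ w < P.W z, ∀ S < 2 ^ P.κ, Q w S →
    P.Allowed z S w ∧ ∀ S' < 2 ^ P.κ, S' ≠ S → Q w S' → P.Disj S S') ∧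
  ∀ S < 2 ^ P.κ, dig P.B z S = ((Finset.range (P.W z)).filter fun w => Q w S).card

variable {P}

/-- Only the digits of the cover and of its images enter, and these stay fixed along a step. -/
theorem Allowed.congr {z z' S w : ℕ}
    (h : ∀ i < P.κ + P.κ, dig P.B z (2 ^ P.κ + 1 + i) = dig P.B z' (2 ^ P.κ + 1 + i))
    (ha : P.Allowed z' S w) : P.Allowed z S w := by
  have hC : ∀ i < P.κ, P.C z i = P.C z' i := fun i hi => h i (by omega)
  have hF : ∀ i < P.κ, P.F z i = P.F z' i := fun i hi => by
    simpa only [F, add_assoc] using h (P.κ + i) (by omega)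
  refine ⟨ha.1, fun i hi hb => ?_⟩
  obtain ⟨h1, h2⟩ := ha.2 i hi hb
  refine ⟨by rwa [hF i hi], fun j hj hg => ?_⟩
  rw [hF j hj]
  rw [hC i hi, hC j hj] at hg
  exact h2 j hj hg

/-- The steps that lead to `z` treat the host vertices one by one; each vertex is given the types
whose digit grew in its step. -/
theorem Reach.exists_family {z : ℕ} (h : P.Reach z) : ∃ Q, P.Family z Q := by
  classical
  induction h with
  | @init z h =>
    refine ⟨fun _ _ => False, ?_, fun S hS => ?_⟩
    · simp
    · simp [h.2 S hS]
  | @step z' z hlt _ hst ih =>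
    obtain ⟨Q, hQ, hc⟩ := ih
    obtain ⟨hW, hhi, hS⟩ := hst
    -- The step from `z'` to `z` treats the host vertex `P.W z'`; the assignment for earlier
    -- vertices is kept.
    obtain ⟨Q', hlt', heq'⟩ : ∃ Q' : ℕ → ℕ → Prop, (∀ w < P.W z', Q' w = Q w) ∧
        ∀ S, Q' (P.W z') S ↔ dig P.B z S = dig P.B z' S + 1 :=
      ⟨fun w S => if w < P.W z' then Q w S else dig P.B z S = dig P.B z' S + 1,
        fun w hw => by simp [hw], fun S => by simp⟩
    refine ⟨Q', fun w hw S hSE hq => ?_, fun S hSE => ?_⟩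
    · by_cases hw' : w < P.W z'
      · rw [hlt' w hw'] at hq ⊢
        obtain ⟨h1, h2⟩ := hQ w hw' S hSE hq
        exact ⟨h1.congr hhi, h2⟩
      · obtain rfl : w = P.W z' := by omega
        rw [heq'] at hq
        simp only [heq']
        rcases hS S hSE with h | h
        · omega
        · exact ⟨h.2.1, h.2.2⟩
    · have : ((Finset.range (P.W z')).filter fun w => Q' w S) =
          (Finset.range (P.W z')).filter fun w => Q w S :=
        Finset.filter_congr fun w hw => by rw [hlt' w (Finset.mem_range.1 hw)]
      rw [hW, card_filter_range_succ, this, ← hc S hSE]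
      simp only [heq']
      rcases hS S hSE with h | h
      · simp [h]
      · simp [h.1]

/-- Induction on the number of host vertices considered: forgetting the last one gives the
predecessor. -/
theorem Family.reach {Q : ℕ → ℕ → Prop} (hB : 0 < P.B) : ∀ {z : ℕ}, z < P.B ^ numDigits P.κ →
    P.Family z Q → P.Reach z := by
  classical
  intro z
  induction hw : P.W z generalizing z with
  | zero =>
    intro _ hQ
    refine .init ⟨hw, fun S hS => ?_⟩
    rw [hQ.2 S hS, hw]
    simp
  | succ w ih =>
    intro hz hQ
    have hcard : ∀ S < 2 ^ P.κ, dig P.B z S =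
        ((Finset.range w).filter fun w => Q w S).card + if Q w S then 1 else 0 := by
      intro S hS
      rw [hQ.2 S hS, hw, card_filter_range_succ]
    -- The predecessor counts only the host vertices below `w` and keeps cover and images. Its
    -- digits do not exceed those of `z`, so they fit the base.
    obtain ⟨z', hz', hd⟩ := exists_dig hB (numDigits P.κ) (fun i =>
      if i < 2 ^ P.κ then ((Finset.range w).filter fun w => Q w i).card
      else if i = 2 ^ P.κ then w else dig P.B z i) (by
        intro i _
        have := dig_lt hB z i
        split_ifs with h h'
        · have := hcard i h
          omega
        · subst h'
          change P.W z < _ at this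
          omega
        · exact this)
    have hlow : ∀ S < 2 ^ P.κ, dig P.B z' S = ((Finset.range w).filter fun w => Q w S).card :=
      fun S hS => by rw [hd S (by unfold numDigits; omega), if_pos hS]
    have hW' : P.W z' = w := by
      rw [W, hd _ (by unfold numDigits; omega)]
      simp
    have hhi : ∀ i < P.κ + P.κ, dig P.B z (2 ^ P.κ + 1 + i) = dig P.B z' (2 ^ P.κ + 1 + i) :=
      fun i hi => by
        rw [hd (2 ^ P.κ + 1 + i) (by unfold numDigits; omega), if_neg (by omega),
          if_neg (by omega)]
    -- Digitwise comparison gives `z' ≤ z`; equality is impossible because `P.W` differs.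
    refine .step (z' := z') (lt_of_le_of_ne (le_of_dig_le (numDigits P.κ) hz' fun i hi => ?_) ?_)
      (ih hW' hz' ⟨fun u hu S hS hq => ?_, fun S hS => ?_⟩) ⟨by rw [hw, hW'], hhi, fun S hS => ?_⟩
    · rw [hd i hi]
      split_ifs with h h'
      · rw [hcard i h]
        omega
      · rw [h']
        change _ ≤ P.W z
        omega
      · exact le_rfl
    · rintro rfl
      omega
    · rw [hW'] at hu
      obtain ⟨h1, h2⟩ := hQ.1 u (by omega) S hS hq
      exact ⟨h1.congr fun i hi => (hhi i hi).symm, h2⟩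
    · rw [hlow S hS, hW']
    · rw [hcard S hS, hlow S hS, hW']
      by_cases hq : Q w S
      · refine .inr ⟨by simp [hq], (hQ.1 w (by omega) S hS hq).1, fun S' hS' hne h => ?_⟩
        refine (hQ.1 w (by omega) S hS hq).2 S' hS' hne ?_
        rw [hcard S' hS', hlow S' hS'] at h
        by_contra hq'
        simp [hq'] at h
      · simp [hq]

end Inst

/-! ### Certificates and locally injective homomorphisms -/

namespace Inst

variable {P : Inst}

/-- The two graphs are symmetric graphs on `n` and `m` vertices and fit the base. -/
structure WellFormed (P : Inst) : Prop where
  n_lt : P.n < P.B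
  m_lt : P.m < P.B
  lt_n : ∀ {u v}, P.G u v → u < P.n
  symm_G : ∀ {u v}, P.G u v → P.G v u
  symm_H : ∀ {u v}, P.H u v → P.H v u

/-- `f` restricts to a locally injective homomorphism. -/
structure IsHom (P : Inst) (f : ℕ → ℕ) : Prop where
  lt : ∀ v < P.n, f v < P.m
  adj : ∀ {u v}, P.G u v → P.H (f u) (f v)
  inj : ∀ {u v v'}, P.G u v → P.G u v' → f v = f v' → v = v'

/-- The map sends the cover to the guessed images, and injects the vertices of each nonempty type
into the host vertices that receive this type. For local injectivity at `u`, two neighbours in the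
cover are handled by `Consistent`, a mixed pair by `Allowed`, and two neighbours outside the cover
by injectivity within a type or by disjointness of distinct types. -/
theorem Final.exists_isHom {z : ℕ} (hP : P.WellFormed) (h : P.Final z) : ∃ f, P.IsHom f := by
  classical
  obtain ⟨hcov, hcon, hW, hm, hcnt, hreach⟩ := h
  obtain ⟨Q, hQ, hdig⟩ := hreach.exists_family
  -- The digit of `S` equals both the number of vertices of type `S` and the number of host vertices
  -- that receive `S`. The hypotheses on `S` stand under the existential so that `choose` yields one
  -- injection for each `S`.
  have hinj : ∀ S, ∃ e : ℕ → ℕ, S < 2 ^ P.κ → S ≠ 0 →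
      (∀ v < P.n, P.IsType z S v → e v < P.m ∧ Q (e v) S) ∧
      ∀ v < P.n, ∀ v' < P.n, P.IsType z S v → P.IsType z S v' → e v = e v' → v = v' := by
    intro S
    by_cases hS : S < 2 ^ P.κ ∧ S ≠ 0
    · have hc := (hcnt S hS.1 hS.2).symm.trans (hdig S hS.1)
      rw [count] at hc
      obtain ⟨e, he, hi⟩ := Set.Finite.exists_injOn_of_encard_le
        (s := ((Finset.range P.n).filter (P.IsType z S) : Set ℕ))
        (t := ((Finset.range (P.W z)).filter fun w => Q w S : Set ℕ)) (Finset.finite_toSet _)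
        (by rw [Set.encard_coe_eq_coe_finsetCard, Set.encard_coe_eq_coe_finsetCard, hc])
      refine ⟨e, fun _ _ => ⟨fun v hv ht => ?_, fun v hv v' hv' ht ht' h => hi ?_ ?_ h⟩⟩
      · simpa [hW] using he (show v ∈ _ by simpa using ⟨hv, ht⟩)
      · simpa using ⟨hv, ht⟩
      · simpa using ⟨hv', ht'⟩
    · exact ⟨id, fun h h' => absurd ⟨h, h'⟩ hS⟩
  choose e he using hinj
  choose S hSlt hS using fun v => exists_testBit_iff P.κ fun i => P.G (P.C z i) v
  -- A cover vertex may occupy several positions; consistency makes its image independent of the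
  -- position chosen. Outside vertices of type `0` are isolated and go to host vertex `0`.
  have hf : ∃ f : ℕ → ℕ, (∀ i < P.κ, f (P.C z i) = P.F z i) ∧
      ∀ v, ¬ P.InCover z v → f v = if S v = 0 then 0 else e (S v) v := by
    refine ⟨fun v => if h : P.InCover z v then P.F z h.choose
      else if S v = 0 then 0 else e (S v) v, fun i hi => ?_, fun v hv => by simp [hv]⟩
    have h : P.InCover z (P.C z i) := ⟨i, hi, rfl⟩
    simp only [h, dif_pos]
    exact ((hcon _ h.choose_spec.1).2 i hi).1 h.choose_spec.2
  obtain ⟨f, hfC, hfI⟩ := hf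
  have hcov' : ∀ {u v}, P.G u v → P.InCover z u ∨ P.InCover z v := by
    intro u v huv
    obtain ⟨i, hi, h | h⟩ := hcov u (hP.lt_n huv) v (hP.lt_n (hP.symm_G huv)) huv
    · exact .inl ⟨i, hi, h.symm⟩
    · exact .inr ⟨i, hi, h.symm⟩
  have hout : ∀ {i v}, i < P.κ → ¬ P.InCover z v → P.G (P.C z i) v →
      P.IsType z (S v) v ∧ S v ≠ 0 ∧ (S v).testBit i = true ∧ f v = e (S v) v ∧ f v < P.m ∧
      Q (f v) (S v) ∧ P.Allowed z (S v) (f v) := by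
    intro i v hi hv hg
    have hb := (hS v i hi).2 hg
    have h0 : S v ≠ 0 := fun h => by simp [h] at hb
    have hfv := hfI v hv
    rw [if_neg h0] at hfv
    have ht : P.IsType z (S v) v := ⟨hv, hS v⟩
    obtain ⟨h1, h2⟩ := (he _ (hSlt v) h0).1 v (hP.lt_n (hP.symm_G hg)) ht
    rw [← hfv] at h1 h2
    exact ⟨ht, h0, hb, hfv, h1, h2, (hQ _ (hW.symm ▸ h1) _ (hSlt v) h2).1⟩
  have hadj : ∀ {i v}, i < P.κ → P.G (P.C z i) v → P.H (P.F z i) (f v) := by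
    intro i v hi hg
    by_cases hv : P.InCover z v
    · obtain ⟨j, hj, rfl⟩ := hv
      rw [hfC j hj]
      exact ((hcon i hi).2 j hj).2.1 hg
    · obtain ⟨-, -, hb, -, -, -, ha⟩ := hout hi hv hg
      exact (ha.2 i hi hb).1
  -- Since `v` lies outside the cover, its neighbour `u` lies in it, at a position `j` of the type
  -- of `v`; being allowed then excludes the image of the other neighbour of `u`.
  have hmix : ∀ {u i v}, i < P.κ → ¬ P.InCover z v → P.G u (P.C z i) → P.G u v →
      f (P.C z i) ≠ f v := by
    intro u i v hi hv hg hg'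
    obtain ⟨j, hj, rfl⟩ := (hcov' hg').resolve_right hv
    obtain ⟨-, -, hb, -, -, -, ha⟩ := hout hj hv hg'
    rw [hfC i hi]
    exact (ha.2 j hj hb).2 i hi hg
  refine ⟨f, fun v hv => ?_, fun {u v} huv => ?_, fun {u v v'} hv hv' hff => ?_⟩
  · by_cases hc : P.InCover z v
    · obtain ⟨i, hi, rfl⟩ := hc
      rw [hfC i hi]
      exact (hcon i hi).1 hv
    · rw [hfI v hc]
      split_ifs with h0
      · omega
      · exact ((he _ (hSlt v) h0).1 v hv ⟨hc, hS v⟩).1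
  · rcases hcov' huv with ⟨i, hi, rfl⟩ | ⟨i, hi, rfl⟩
    · rw [hfC i hi]
      exact hadj hi huv
    · rw [hfC i hi]
      exact hP.symm_H (hadj hi (hP.symm_G huv))
  · by_cases hc : P.InCover z v <;> by_cases hc' : P.InCover z v'
    · obtain ⟨i, hi, rfl⟩ := hc
      obtain ⟨j, hj, rfl⟩ := hc'
      rw [hfC i hi, hfC j hj] at hff
      exact ((hcon i hi).2 j hj).2.2 u (hP.lt_n hv) hv hv' hff
    · obtain ⟨i, hi, rfl⟩ := hc
      exact absurd hff (hmix hi hc' hv hv')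
    · obtain ⟨i, hi, rfl⟩ := hc'
      exact absurd hff.symm (hmix hi hc hv' hv)
    · obtain ⟨i, hi, rfl⟩ := (hcov' hv).resolve_right hc
      obtain ⟨ht, h0, hb, hfe, hlt, hq, -⟩ := hout hi hc hv
      obtain ⟨ht', -, hb', hfe', -, hq', -⟩ := hout hi hc' hv'
      -- Both types contain position `i`, so they are not disjoint; distinct types could not meet at
      -- one host vertex.
      by_cases hSS : S v' = S v
      · rw [hSS] at ht' hfe'
        exact (he _ (hSlt v) h0).2 v (hP.lt_n (hP.symm_G hv)) v' (hP.lt_n (hP.symm_G hv')) ht ht'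
          (by rw [← hfe, ← hfe', hff])
      · rw [← hff] at hq'
        exact absurd ⟨hb, hb'⟩
          ((hQ _ (hW.symm ▸ hlt) _ (hSlt v) hq).2 _ (hSlt v') hSS hq' i hi)

/-- The certificate is read off from `f` and the cover `c`. Vertices of one nonempty type share a
neighbour, so `f` maps them bijectively onto the host vertices that receive this type. -/
theorem IsHom.exists_final {f c : ℕ → ℕ} (hP : P.WellFormed) (hf : P.IsHom f)
    (hc : ∀ i, c i ≤ P.n) (hcov : ∀ {u v}, P.G u v → ∃ i < P.κ, u = c i ∨ v = c i) :
    ∃ z < P.B ^ numDigits P.κ, P.Final z := by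
  classical
  have hB : 0 < P.B := (Nat.zero_le _).trans_lt hP.n_lt
  -- Type `0` is left out: `f` need not be injective on isolated vertices, and their number is not
  -- checked.
  obtain ⟨Q, hQ⟩ : ∃ Q : ℕ → ℕ → Prop, ∀ w S, Q w S ↔ S ≠ 0 ∧ ∃ v < P.n, f v = w ∧
      (∀ i < P.κ, c i ≠ v) ∧ ∀ i < P.κ, (S.testBit i = true ↔ P.G (c i) v) := ⟨_, fun _ _ => Iff.rfl⟩
  -- The four blocks are the counts, the number of host vertices, the cover and its images. Unused
  -- positions get image `0`, because nothing bounds `f` outside the guest graph.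
  obtain ⟨z, hz, hd⟩ := exists_dig hB (numDigits P.κ) (fun i =>
    if i < 2 ^ P.κ then ((Finset.range P.m).filter fun w => Q w i).card
    else if i = 2 ^ P.κ then P.m
    else if i < 2 ^ P.κ + 1 + P.κ then c (i - (2 ^ P.κ + 1))
    else if c (i - (2 ^ P.κ + 1 + P.κ)) < P.n then f (c (i - (2 ^ P.κ + 1 + P.κ))) else 0) (by
      intro i _
      have := hP.m_lt
      split_ifs with h1 h2 h3 h4
      · refine (Finset.card_filter_le _ _).trans_lt ?_
        simpa using hP.m_lt
      · exact hP.m_lt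
      · exact (hc _).trans_lt hP.n_lt
      · exact (hf.lt _ h4).trans hP.m_lt
      · exact hB)
  have hlow : ∀ S < 2 ^ P.κ, dig P.B z S = ((Finset.range P.m).filter fun w => Q w S).card :=
    fun S hS => by rw [hd S (by unfold numDigits; omega), if_pos hS]
  have hW : P.W z = P.m := by
    rw [W, hd _ (by unfold numDigits; omega)]
    simp
  have hC : ∀ i < P.κ, P.C z i = c i := fun i hi => by
    rw [C, hd _ (by unfold numDigits; omega), if_neg (by omega), if_neg (by omega),
      if_pos (by omega), Nat.add_sub_cancel_left]
  have hF : ∀ i < P.κ, c i < P.n → P.F z i = f (c i) := fun i hi hn => by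
    rw [F, hd _ (by unfold numDigits; omega), if_neg (by omega), if_neg (by omega),
      if_neg (by omega), Nat.add_sub_cancel_left, if_pos hn]
  have hF' : ∀ i < P.κ, ¬ c i < P.n → P.F z i = 0 := fun i hi hn => by
    rw [F, hd _ (by unfold numDigits; omega), if_neg (by omega), if_neg (by omega),
      if_neg (by omega), Nat.add_sub_cancel_left, if_neg hn]
  have hrt : ∀ {u v}, P.G u v → v < P.n := fun h => hP.lt_n (hP.symm_G h)
  refine ⟨z, hz, fun u _ v _ huv => ?_, fun i hi => ⟨fun hn => ?_, fun j hj => ⟨fun h => ?_,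
    fun h => ?_, fun v _ h h' hff => ?_⟩⟩, hW, ?_, fun S hS h0 => ?_, ?_⟩
  · obtain ⟨i, hi, h⟩ := hcov huv
    exact ⟨i, hi, by rwa [hC i hi]⟩
  · rw [hC i hi] at hn
    rw [hF i hi hn]
    exact hf.lt _ hn
  · rw [hC i hi, hC j hj] at h
    by_cases hn : c i < P.n
    · rw [hF i hi hn, hF j hj (h ▸ hn), h]
    · rw [hF' i hi hn, hF' j hj (h ▸ hn)]
  · rw [hC i hi, hC j hj] at h
    rw [hF i hi (hP.lt_n h), hF j hj (hrt h)]
    exact hf.adj h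
  · rw [hC i hi] at h ⊢
    rw [hC j hj] at h' ⊢
    rw [hF i hi (hrt h), hF j hj (hrt h')] at hff
    exact hf.inj h h' hff
  · by_contra! h
    have := hf.lt 0 (by omega)
    omega
  · rw [hlow S hS, count]
    have hT : ∀ v, P.IsType z S v ↔ (∀ i < P.κ, c i ≠ v) ∧
        ∀ i < P.κ, (S.testBit i = true ↔ P.G (c i) v) := fun v => by
      refine and_congr ?_ (forall₂_congr fun i hi => by rw [hC i hi])
      simp only [InCover, not_exists, not_and]
      exact forall₂_congr fun i hi => by rw [hC i hi]
    symm
    obtain ⟨i, hi, hb⟩ := exists_testBit hS h0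
    refine Finset.card_bij (fun v _ => f v) ?_ ?_ ?_
    · intro v hv
      simp only [Finset.mem_filter, Finset.mem_range, hT] at hv ⊢
      exact ⟨hf.lt v hv.1, (hQ _ _).2 ⟨h0, v, hv.1, rfl, hv.2⟩⟩
    · intro v hv v' hv' h
      simp only [Finset.mem_filter, Finset.mem_range, hT] at hv hv'
      exact hf.inj ((hv.2.2 i hi).1 hb) ((hv'.2.2 i hi).1 hb) h
    · intro w hw
      simp only [Finset.mem_filter, Finset.mem_range, hT] at hw ⊢
      obtain ⟨-, v, hv, rfl, h⟩ := (hQ _ _).1 hw.2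
      exact ⟨v, ⟨hv, h⟩, rfl⟩
  -- Both conditions come from local injectivity at a cover vertex: an image shared with a cover
  -- neighbour would put `v` into the cover, and two intersecting types at one host vertex would
  -- belong to the same vertex.
  · refine Family.reach (Q := Q) hB hz ⟨fun w _ S hS hq => ?_, fun S hS => by rw [hlow S hS, hW]⟩
    obtain ⟨h0, v, hv, rfl, hvc, hvS⟩ := (hQ _ _).1 hq
    refine ⟨⟨h0, fun i hi hb => ?_⟩, fun S' hS' hne hq' i hi hb => ?_⟩
    · have hg := (hvS i hi).1 hb
      rw [hF i hi (hP.lt_n hg)]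
      refine ⟨hf.adj hg, fun j hj hg' h => ?_⟩
      rw [hC i hi, hC j hj] at hg'
      rw [hF j hj (hrt hg')] at h
      exact hvc j hj (hf.inj hg' hg h)
    · obtain ⟨-, v', hv', hff, -, hvS'⟩ := (hQ _ _).1 hq'
      obtain rfl := hf.inj ((hvS i hi).1 hb.1) ((hvS' i hi).1 hb.2) hff.symm
      exact hne (eq_of_testBit_iff hS' hS fun i hi => (hvS' i hi).trans (hvS i hi).symm)

end Inst

/-! ## Bounded formulas -/

namespace Term

/-- A term holds if its value is nonzero. -/
def Sat (X : ℕ) (A : ℕ → ℕ → ℕ) (t : Term) (ρ : ℕ → ℕ) : Prop := t.eval X A ρ ≠ 0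

def not (t : Term) : Term := .sub (.const 1) t
def and (a b : Term) : Term := .ite a b (.const 0)
def or (a b : Term) : Term := .ite a (.const 1) b
def imp (a b : Term) : Term := .ite a b (.const 1)
def iff (a b : Term) : Term := .ite a b b.not
def lt (a b : Term) : Term := .sub b a
def eq (a b : Term) : Term := .not (.add (.sub a b) (.sub b a))
def all (r : ℕ) (t : Term) : Term := .not (.sum r t.not)
def exB (r : ℕ) (b t : Term) : Term := .sum r (.and (.lt (.var r) b) t)
def allB (r : ℕ) (b t : Term) : Term := .all r (.imp (.lt (.var r) b) t)
-- A sum of `a` copies of `b`, so only the first factor must be at most the size. `let2` evaluates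
-- the arguments before it binds its variables, hence nested uses capture nothing.
def mul (a b : Term) : Term :=
  .let2 40 41 a b (.sum 42 (.ite (.lt (.var 42) (.var 40)) (.var 41) (.const 0)))
-- Counts the `i` with `(i + 1) * b ≤ a`.
def div (a b : Term) : Term :=
  .let2 40 41 a b (.sum 43 (.ite (.lt (.var 40) (.mul (.add (.var 43) (.const 1)) (.var 41)))
    (.const 0) (.const 1)))

variable {X : ℕ} {A : ℕ → ℕ → ℕ} {ρ : ℕ → ℕ} {a b t : Term}

@[simp] theorem eval_const (c : ℕ) : (Term.const c).eval X A ρ = c := rfl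
@[simp] theorem eval_var (r : ℕ) : (Term.var r).eval X A ρ = ρ r := rfl
@[simp] theorem eval_get (i : ℕ) : (Term.get i t).eval X A ρ = A i (t.eval X A ρ) := rfl
@[simp] theorem eval_add : (Term.add a b).eval X A ρ = a.eval X A ρ + b.eval X A ρ := rfl
@[simp] theorem eval_sub : (Term.sub a b).eval X A ρ = a.eval X A ρ - b.eval X A ρ := rfl

@[simp] theorem sat_not : t.not.Sat X A ρ ↔ ¬ t.Sat X A ρ := by
  simp [Sat, not]; omega

@[simp] theorem sat_and : (a.and b).Sat X A ρ ↔ a.Sat X A ρ ∧ b.Sat X A ρ := by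
  simp [Sat, and, eval]

@[simp] theorem sat_or : (a.or b).Sat X A ρ ↔ a.Sat X A ρ ∨ b.Sat X A ρ := by
  simp only [Sat, or, eval]; split_ifs <;> simp_all

@[simp] theorem sat_imp : (a.imp b).Sat X A ρ ↔ (a.Sat X A ρ → b.Sat X A ρ) := by
  simp only [Sat, imp, eval]; split_ifs <;> simp_all

@[simp] theorem sat_iff : (a.iff b).Sat X A ρ ↔ (a.Sat X A ρ ↔ b.Sat X A ρ) := by
  by_cases h : a.Sat X A ρ
  · have h' : a.eval X A ρ ≠ 0 := h
    simp [Sat, iff, eval, h']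
  · have h' : ¬ a.eval X A ρ ≠ 0 := h
    rw [← not_iff_not (b := b.Sat X A ρ), ← sat_not (t := b)]
    simp only [Sat, iff, eval, h', if_false, not_false_eq_true, true_iff]

@[simp] theorem sat_lt : (a.lt b).Sat X A ρ ↔ a.eval X A ρ < b.eval X A ρ := by
  simp [Sat, lt]; omega

@[simp] theorem sat_eq : (a.eq b).Sat X A ρ ↔ a.eval X A ρ = b.eval X A ρ := by
  simp only [eq, sat_not]; simp [Sat]; omega

@[simp] theorem sat_sum {r : ℕ} :
    (Term.sum r t).Sat X A ρ ↔ ∃ i < X, t.Sat X A (Function.update ρ r i) := by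
  simp [Sat, eval, Finset.sum_eq_zero_iff]

@[simp] theorem sat_all {r : ℕ} :
    (t.all r).Sat X A ρ ↔ ∀ i < X, t.Sat X A (Function.update ρ r i) := by
  simp [all]

/-- Sums see only numbers below `X`, whence `N ≤ X`; the bound must not depend on the bound
variable. -/
theorem sat_exB {r N : ℕ} {p : ℕ → Prop} (hN : N ≤ X)
    (hb : ∀ i, b.eval X A (Function.update ρ r i) = N)
    (h : ∀ i < N, (t.Sat X A (Function.update ρ r i) ↔ p i)) :
    (exB r b t).Sat X A ρ ↔ ∃ i < N, p i := by
  simp only [exB, sat_sum, sat_and, sat_lt, eval_var, Function.update_self, hb]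
  exact ⟨fun ⟨i, _, hi, ht⟩ => ⟨i, hi, (h i hi).1 ht⟩,
    fun ⟨i, hi, ht⟩ => ⟨i, hi.trans_le hN, hi, (h i hi).2 ht⟩⟩

theorem sat_allB {r N : ℕ} {p : ℕ → Prop} (hN : N ≤ X)
    (hb : ∀ i, b.eval X A (Function.update ρ r i) = N)
    (h : ∀ i < N, (t.Sat X A (Function.update ρ r i) ↔ p i)) :
    (allB r b t).Sat X A ρ ↔ ∀ i < N, p i := by
  simp only [allB, sat_all, sat_imp, sat_lt, eval_var, Function.update_self, hb]
  exact ⟨fun H i hi => (h i hi).1 (H i (hi.trans_le hN) hi),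
    fun H i _ hi => (h i hi).2 (H i hi)⟩

theorem eval_mul (h : a.eval X A ρ ≤ X) :
    (a.mul b).eval X A ρ = a.eval X A ρ * b.eval X A ρ := by
  have hsum : ∀ n, ∀ k ≤ n, ∀ c : ℕ, (∑ i ∈ Finset.range n, if i < k then c else 0) = k * c := by
    intro n k hk c
    rw [← Finset.sum_filter, Finset.sum_const, smul_eq_mul]
    congr 1
    rw [show (Finset.range n).filter (fun i => i < k) = Finset.range k by ext; simp; omega,
      Finset.card_range]
  simp only [mul, eval, lt]
  simpa [Nat.sub_eq_zero_iff_le, Nat.not_le, ← Nat.pos_iff_ne_zero] using hsum X _ h (b.eval X A ρ)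

theorem eval_div (h : a.eval X A ρ < X) (hb : 0 < b.eval X A ρ) :
    (a.div b).eval X A ρ = a.eval X A ρ / b.eval X A ρ := by
  have h1 : ∀ i < X, ((Term.add (.var 43) (.const 1)).mul (.var 41)).eval X A
      (Function.update (Function.update (Function.update ρ 40 (a.eval X A ρ)) 41 (b.eval X A ρ))
        43 i) = (i + 1) * b.eval X A ρ := by
    intro i hi
    rw [eval_mul (by simpa using hi)]
    simp
  simp only [div, eval, lt]
  rw [Finset.sum_congr rfl (g := fun i => if i < a.eval X A ρ / b.eval X A ρ then 1 else 0)
    fun i hi => ?_]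
  · rw [← Finset.sum_filter, Finset.sum_const, smul_eq_mul, mul_one]
    have := Nat.div_le_self (a.eval X A ρ) (b.eval X A ρ)
    rw [show (Finset.range X).filter (fun i => i < a.eval X A ρ / b.eval X A ρ) =
      Finset.range (a.eval X A ρ / b.eval X A ρ) by ext; simp; omega, Finset.card_range]
  · simp only [h1 i (Finset.mem_range.1 hi)]
    have := Nat.le_div_iff_mul_le hb (x := i + 1) (y := a.eval X A ρ)
    simp only [Function.update_apply]
    by_cases hc : i + 1 ≤ a.eval X A ρ / b.eval X A ρ
    · simp [this.1 hc, Nat.lt_of_succ_le hc]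
    · have h2 := mt this.2 hc
      have : ¬ i < a.eval X A ρ / b.eval X A ρ := hc
      simp [this]; omega

end Term

/-! ## The search for a certificate as bounded formulas

Variables `0` to `4` hold `κ`, `B`, `2 ^ κ`, `n`, `m`. -/

theorem numDigits_lt_pow {B κ : ℕ} (hB : 2 ≤ B) : numDigits κ < B ^ numDigits κ :=
  Nat.lt_pow_self hB

theorem le_pow_numDigits (B κ : ℕ) : B ≤ B ^ numDigits κ := by
  rcases Nat.eq_zero_or_pos B with rfl | hB
  · simp
  · exact Nat.le_self_pow (by simp [numDigits]) B

/-- The size and the arrays fit the instance: array `0` holds the two graphs, array `1` the powers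
of two, array `2` the powers of the base. -/
structure Inst.Stored (P : Inst) (X : ℕ) (A : ℕ → ℕ → ℕ) : Prop where
  size : X = P.B ^ numDigits P.κ
  two_le : 2 ≤ P.B
  n_lt : P.n < P.B
  m_lt : P.m < P.B
  pow_two : ∀ i < X, A 1 i = 2 ^ i
  pow_base : ∀ i < X, A 2 i = P.B ^ i
  adj_G : ∀ u v, P.G u v ↔ u < P.n ∧ v < P.n ∧ A 0 (P.n + P.m + 2 + P.n * u + v) ≠ 0
  adj_H : ∀ u v, P.H u v ↔ u < P.m ∧ v < P.m ∧ A 0 (P.n + P.m + 2 + P.n * P.n + P.m * u + v) ≠ 0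

/-- The variables that describe the instance have the right values. -/
structure Inst.Vars (P : Inst) (ρ : ℕ → ℕ) : Prop where
  κ : ρ 0 = P.κ
  base : ρ 1 = P.B
  pow : ρ 2 = 2 ^ P.κ
  n : ρ 3 = P.n
  m : ρ 4 = P.m

theorem Inst.Vars.update {P : Inst} {ρ : ℕ → ℕ} (h : P.Vars ρ) {r v : ℕ} (hr : 4 < r) :
    P.Vars (Function.update ρ r v) := by
  constructor
  · rw [Function.update_of_ne (by omega), h.κ]
  · rw [Function.update_of_ne (by omega), h.base]
  · rw [Function.update_of_ne (by omega), h.pow]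
  · rw [Function.update_of_ne (by omega), h.n]
  · rw [Function.update_of_ne (by omega), h.m]

namespace Term

/-- A recurrence for `Term.fill`: cell `i + 1` is computed from cell `i`. -/
def powTwo : Term :=
  .ite (.var 5) (.add (.get 1 (.sub (.var 5) (.const 1))) (.get 1 (.sub (.var 5) (.const 1))))
    (.const 1)
-- The base stands first in the product because it is at most the size, whereas the powers in the
-- table exceed it.
def powBase : Term :=
  .ite (.var 5) (.mul (.var 1) (.get 2 (.sub (.var 5) (.const 1)))) (.const 1)
def mod (a b : Term) : Term := .let2 46 47 a b
  (.sub (.var 46) (.mul (.div (.var 46) (.var 47)) (.var 47)))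
def digit (z i : Term) : Term := .mod (.div z (.get 2 i)) (.var 1)
def bit (S i : Term) : Term := .mod (.div S (.get 1 i)) (.const 2)
-- The matrices begin after the two unary numbers and their two end marks. The comparisons keep
-- other pairs from hitting foreign cells.
def adjG (u v : Term) : Term := .let2 48 49 u v (.and (.lt (.var 48) (.var 3))
  (.and (.lt (.var 49) (.var 3)) (.get 0 (.add (.add (.add (.add (.var 3) (.var 4)) (.const 2))
    (.mul (.var 3) (.var 48))) (.var 49)))))
def adjH (u v : Term) : Term := .let2 48 49 u v (.and (.lt (.var 48) (.var 4))
  (.and (.lt (.var 49) (.var 4)) (.get 0 (.add (.add (.add (.add (.add (.var 3) (.var 4))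
    (.const 2)) (.mul (.var 3) (.var 3))) (.mul (.var 4) (.var 48))) (.var 49)))))
def cov (z i : Term) : Term := .digit z (.add (.add (.var 2) (.const 1)) i)
def img (z i : Term) : Term := .digit z (.add (.add (.add (.var 2) (.const 1)) (.var 0)) i)
def placed (z : Term) : Term := .digit z (.var 2)

/-- The first `j` positions of the certificate in variable `10` form a vertex cover. -/
def covers (j : Term) : Term :=
  .allB 15 (.var 3) (.allB 14 (.var 3) (.imp (.adjG (.var 15) (.var 14))
    (.exB 12 j (.or (.eq (.var 15) (.cov (.var 10) (.var 12)))
      (.eq (.var 14) (.cov (.var 10) (.var 12)))))))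

def consistent : Term :=
  .allB 12 (.var 0) (.and
    (.imp (.lt (.cov (.var 10) (.var 12)) (.var 3)) (.lt (.img (.var 10) (.var 12)) (.var 4)))
    (.allB 13 (.var 0) (.and
      (.imp (.eq (.cov (.var 10) (.var 12)) (.cov (.var 10) (.var 13)))
        (.eq (.img (.var 10) (.var 12)) (.img (.var 10) (.var 13))))
    (.and
      (.imp (.adjG (.cov (.var 10) (.var 12)) (.cov (.var 10) (.var 13)))
        (.adjH (.img (.var 10) (.var 12)) (.img (.var 10) (.var 13))))
      (.allB 14 (.var 3) (.imp (.adjG (.var 14) (.cov (.var 10) (.var 12)))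
        (.imp (.adjG (.var 14) (.cov (.var 10) (.var 13)))
        (.imp (.eq (.img (.var 10) (.var 12)) (.img (.var 10) (.var 13)))
          (.eq (.cov (.var 10) (.var 12)) (.cov (.var 10) (.var 13)))))))))))

def allowed : Term :=
  .and (.var 16) (.allB 12 (.var 0) (.imp (.bit (.var 16) (.var 12)) (.and
    (.adjH (.img (.var 10) (.var 12)) (.placed (.var 11)))
    (.allB 13 (.var 0) (.imp (.adjG (.cov (.var 10) (.var 12)) (.cov (.var 10) (.var 13)))
      (.not (.eq (.img (.var 10) (.var 13)) (.placed (.var 11)))))))))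

def disj : Term :=
  .allB 12 (.var 0) (.not (.and (.bit (.var 16) (.var 12)) (.bit (.var 17) (.var 12))))

def isType : Term :=
  .and (.not (.exB 12 (.var 0) (.eq (.cov (.var 10) (.var 12)) (.var 14))))
    (.allB 12 (.var 0) (.iff (.bit (.var 16) (.var 12))
      (.adjG (.cov (.var 10) (.var 12)) (.var 14))))

def count : Term := .sum 14 (.ite (.and (.lt (.var 14) (.var 3)) .isType) (.const 1) (.const 0))

def init : Term :=
  .and (.eq (.placed (.var 10)) (.const 0))
    (.allB 16 (.var 2) (.eq (.digit (.var 10) (.var 16)) (.const 0)))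

/-- With an index up to `κ + κ`, `cov` also runs through the images, which follow the cover in the
digit vector. -/
def step : Term :=
  .and (.eq (.placed (.var 10)) (.add (.placed (.var 11)) (.const 1))) (.and
    (.allB 12 (.add (.var 0) (.var 0)) (.eq (.cov (.var 10) (.var 12)) (.cov (.var 11) (.var 12))))
    (.allB 16 (.var 2) (.or
      (.eq (.digit (.var 10) (.var 16)) (.digit (.var 11) (.var 16)))
      (.and (.eq (.digit (.var 10) (.var 16)) (.add (.digit (.var 11) (.var 16)) (.const 1)))
      (.and .allowed
      (.allB 17 (.var 2) (.imp (.not (.eq (.var 17) (.var 16)))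
        (.imp (.eq (.digit (.var 10) (.var 17)) (.add (.digit (.var 11) (.var 17)) (.const 1)))
          .disj))))))))

/-- Whether the certificate in variable `10` is reachable, given the previous cells of
array `3`. -/
def reach : Term :=
  .ite (.or .init (.exB 11 (.var 10) (.and (.get 3 (.var 11)) .step))) (.const 1) (.const 0)

def final : Term :=
  .and (.covers (.var 0)) (.and .consistent (.and (.eq (.placed (.var 10)) (.var 4)) (.and
    (.or (.eq (.var 3) (.const 0)) (.lt (.const 0) (.var 4))) (.and
    (.allB 16 (.var 2) (.imp (.var 16) (.eq (.digit (.var 10) (.var 16)) .count)))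
    (.get 3 (.var 10))))))

variable {P : Inst} {X : ℕ} {A : ℕ → ℕ → ℕ} {ρ : ℕ → ℕ} {a b t : Term}

theorem eval_mod (h : a.eval X A ρ < X) (hb : 0 < b.eval X A ρ) :
    (a.mod b).eval X A ρ = a.eval X A ρ % b.eval X A ρ := by
  have h1 : ((Term.var 46).div (.var 47)).eval X A (Function.update (Function.update ρ 46
      (a.eval X A ρ)) 47 (b.eval X A ρ)) = a.eval X A ρ / b.eval X A ρ := by
    rw [eval_div (by simpa using h) (by simpa using hb)]
    simp
  have h2 := Nat.div_le_self (a.eval X A ρ) (b.eval X A ρ)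
  simp only [mod, eval]
  rw [eval_mul (by omega), h1]
  simp only [eval_var, Function.update_self, ne_eq, Nat.reduceEqDiff, not_false_eq_true,
    Function.update_of_ne]
  rw [mul_comm, ← Nat.mod_eq_sub]

end Term

/-! ### Correctness of the formulas -/

open Term

namespace Inst.Stored

variable {P : Inst} {X : ℕ} {A : ℕ → ℕ → ℕ} {ρ : ℕ → ℕ} {a b t : Term}

/-- All digit positions and all codes of types lie below the size, so they are within reach of sums
and of the tables of powers. -/
theorem lt_size {P : Inst} {X : ℕ} {A : ℕ → ℕ → ℕ} (h : P.Stored X A) :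
    2 ^ P.κ + 1 + (P.κ + P.κ) < X := by
  rw [h.size]
  exact numDigits_lt_pow h.two_le

theorem base_le {P : Inst} {X : ℕ} {A : ℕ → ℕ → ℕ} (h : P.Stored X A) : P.B ≤ X := by
  rw [h.size]
  exact le_pow_numDigits _ _

theorem eval_digit (h : P.Stored X A) (hρ : P.Vars ρ) (hz : a.eval X A ρ < X)
    (hi : b.eval X A ρ < X) :
    (a.digit b).eval X A ρ = dig P.B (a.eval X A ρ) (b.eval X A ρ) := by
  have h2 := h.two_le
  have h1 : (a.div (.get 2 b)).eval X A ρ = a.eval X A ρ / P.B ^ b.eval X A ρ := by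
    rw [eval_div hz] <;> simp [h.pow_base _ hi]
    exact pow_pos (by omega) _
  rw [digit, eval_mod, h1, eval_var, hρ.base, dig]
  · rw [h1]
    exact (Nat.div_le_self _ _).trans_lt hz
  · simp [hρ.base]; omega

theorem sat_bit (h : P.Stored X A) (hz : a.eval X A ρ < X) (hi : b.eval X A ρ < X) :
    (a.bit b).Sat X A ρ ↔ (a.eval X A ρ).testBit (b.eval X A ρ) = true := by
  have h1 : (a.div (.get 1 b)).eval X A ρ = a.eval X A ρ / 2 ^ b.eval X A ρ := by
    rw [eval_div hz] <;> simp [h.pow_two _ hi]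
  rw [bit, Sat, eval_mod, h1, eval_const, Nat.testBit_eq_decide_div_mod_eq]
  · simp
  · rw [h1]
    exact (Nat.div_le_self _ _).trans_lt hz
  · simp

theorem sat_adjG (h : P.Stored X A) (hρ : P.Vars ρ) :
    (a.adjG b).Sat X A ρ ↔ P.G (a.eval X A ρ) (b.eval X A ρ) := by
  have h1 := h.n_lt
  have h2 := h.base_le
  rw [h.adj_G, adjG, Sat, eval, ← Sat, Term.sat_and, Term.sat_and, sat_lt, sat_lt, Sat, eval_get,
    eval_add, eval_add, eval_mul (by simp [hρ.n]; omega)]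
  simp [hρ.n, hρ.m]

theorem sat_adjH (h : P.Stored X A) (hρ : P.Vars ρ) :
    (a.adjH b).Sat X A ρ ↔ P.H (a.eval X A ρ) (b.eval X A ρ) := by
  have h1 := h.n_lt
  have h1' := h.m_lt
  have h2 := h.base_le
  rw [h.adj_H, adjH, Sat, eval, ← Sat, Term.sat_and, Term.sat_and, sat_lt, sat_lt, Sat, eval_get,
    eval_add, eval_add, eval_add, eval_mul (by simp [hρ.n]; omega),
    eval_mul (by simp [hρ.m]; omega)]
  simp [hρ.n, hρ.m]

theorem eval_cov (h : P.Stored X A) (hρ : P.Vars ρ) (hz : a.eval X A ρ < X)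
    (hi : b.eval X A ρ < P.κ) :
    (a.cov b).eval X A ρ = P.C (a.eval X A ρ) (b.eval X A ρ) := by
  have := h.lt_size
  rw [cov, h.eval_digit hρ hz (by simp [hρ.pow]; omega)]
  simp [Inst.C, hρ.pow]

theorem eval_img (h : P.Stored X A) (hρ : P.Vars ρ) (hz : a.eval X A ρ < X)
    (hi : b.eval X A ρ < P.κ) :
    (a.img b).eval X A ρ = P.F (a.eval X A ρ) (b.eval X A ρ) := by
  have := h.lt_size
  rw [img, h.eval_digit hρ hz (by simp [hρ.pow, hρ.κ]; omega)]
  simp [Inst.F, hρ.pow, hρ.κ]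

theorem eval_placed (h : P.Stored X A) (hρ : P.Vars ρ) (hz : a.eval X A ρ < X) :
    (a.placed).eval X A ρ = P.W (a.eval X A ρ) := by
  have := h.lt_size
  rw [placed, h.eval_digit hρ hz (by simp [hρ.pow]; omega)]
  simp [Inst.W, hρ.pow]

end Inst.Stored

namespace Inst.Stored

variable {P : Inst} {X : ℕ} {A : ℕ → ℕ → ℕ} {ρ : ℕ → ℕ} {t : Term}

/-- The term for `j` is evaluated under the quantifiers, hence `ht` asks for its value under every
assignment that describes the instance. It is used for `κ` and for `κ - 1`. -/
theorem sat_covers (h : P.Stored X A) (hρ : P.Vars ρ) (hz : ρ 10 < X) {j : ℕ} (hj : j ≤ P.κ)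
    (ht : ∀ ρ, P.Vars ρ → t.eval X A ρ = j) :
    (covers t).Sat X A ρ ↔ P.Covers j (ρ 10) := by
  have h0 := Nat.two_pow_pos P.κ
  have h1 := h.lt_size
  have h2 := h.base_le
  have h3 := h.n_lt
  have v1 := fun i : ℕ => hρ.update (v := i) (show 4 < 15 by norm_num)
  have v2 := fun i j : ℕ => (v1 i).update (v := j) (show 4 < 14 by norm_num)
  have v3 := fun i j k : ℕ => (v2 i j).update (v := k) (show 4 < 12 by norm_num)
  refine sat_allB (N := P.n) (by omega) (fun i => (v1 i).n) fun u hu => ?_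
  refine sat_allB (N := P.n) (by omega) (fun i => (v2 u i).n) fun v hv => ?_
  rw [sat_imp, h.sat_adjG (v2 u v)]
  refine imp_congr (by simp) ?_
  refine sat_exB (N := j) (by omega) (fun i => ht _ (v3 u v i)) fun i hi => ?_
  simp [h.eval_cov (v3 u v i), hz, hi.trans_le hj]

theorem sat_consistent (h : P.Stored X A) (hρ : P.Vars ρ) (hz : ρ 10 < X) :
    consistent.Sat X A ρ ↔ P.Consistent (ρ 10) := by
  have h0 := Nat.two_pow_pos P.κ
  have h1 := h.lt_size
  have h2 := h.base_le
  have h3 := h.n_lt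
  have v1 := fun i : ℕ => hρ.update (v := i) (show 4 < 12 by norm_num)
  have v2 := fun i j : ℕ => (v1 i).update (v := j) (show 4 < 13 by norm_num)
  have v3 := fun i j k : ℕ => (v2 i j).update (v := k) (show 4 < 14 by norm_num)
  refine sat_allB (N := P.κ) (by omega) (fun i => (v1 i).κ) fun i hi => ?_
  rw [Term.sat_and]
  refine and_congr ?_ ?_
  · simp [h.eval_cov (v1 i), h.eval_img (v1 i), hz, hi, hρ.n, hρ.m]
  refine sat_allB (N := P.κ) (by omega) (fun j => (v2 i j).κ) fun j hj => ?_
  rw [Term.sat_and, Term.sat_and]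
  refine and_congr ?_ (and_congr ?_ ?_)
  · simp [h.eval_cov (v2 i j), h.eval_img (v2 i j), hz, hi, hj]
  · simp [h.sat_adjG (v2 i j), h.sat_adjH (v2 i j), h.eval_cov (v2 i j), h.eval_img (v2 i j),
      hz, hi, hj]
  refine sat_allB (N := P.n) (by omega) (fun v => (v3 i j v).n) fun v hv => ?_
  simp [h.sat_adjG (v3 i j v), h.eval_cov (v3 i j v), h.eval_img (v3 i j v), hz, hi, hj]

theorem sat_allowed (h : P.Stored X A) (hρ : P.Vars ρ) (hz : ρ 10 < X) (hz' : ρ 11 < X)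
    (hS : ρ 16 < X) :
    allowed.Sat X A ρ ↔ P.Allowed (ρ 10) (ρ 16) (P.W (ρ 11)) := by
  have h0 := Nat.two_pow_pos P.κ
  have h1 := h.lt_size
  have v1 := fun i : ℕ => hρ.update (v := i) (show 4 < 12 by norm_num)
  have v2 := fun i j : ℕ => (v1 i).update (v := j) (show 4 < 13 by norm_num)
  rw [allowed, Term.sat_and]
  refine and_congr (by simp [Sat]) ?_
  refine sat_allB (N := P.κ) (by omega) (fun i => (v1 i).κ) fun i hi => ?_
  rw [sat_imp, Term.sat_and]
  refine imp_congr ?_ (and_congr ?_ ?_)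
  · rw [h.sat_bit] <;> simp [hS]
    omega
  · simp [h.sat_adjH (v1 i), h.eval_img (v1 i), h.eval_placed (v1 i), hz, hz', hi]
  refine sat_allB (N := P.κ) (by omega) (fun j => (v2 i j).κ) fun j hj => ?_
  simp [h.sat_adjG (v2 i j), h.eval_cov (v2 i j), h.eval_img (v2 i j), h.eval_placed (v2 i j),
    hz, hz', hi, hj]

theorem sat_disj (h : P.Stored X A) (hρ : P.Vars ρ) (hS : ρ 16 < X) (hS' : ρ 17 < X) :
    disj.Sat X A ρ ↔ P.Disj (ρ 16) (ρ 17) := by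
  have h0 := Nat.two_pow_pos P.κ
  have h1 := h.lt_size
  have v1 := fun i : ℕ => hρ.update (v := i) (show 4 < 12 by norm_num)
  refine sat_allB (N := P.κ) (by omega) (fun i => (v1 i).κ) fun i hi => ?_
  have hi' : i < X := by omega
  simp [h.sat_bit, hS, hS', hi']

theorem sat_isType (h : P.Stored X A) (hρ : P.Vars ρ) (hz : ρ 10 < X) (hS : ρ 16 < X) :
    isType.Sat X A ρ ↔ P.IsType (ρ 10) (ρ 16) (ρ 14) := by
  have h0 := Nat.two_pow_pos P.κ
  have h1 := h.lt_size
  have v1 := fun i : ℕ => hρ.update (v := i) (show 4 < 12 by norm_num)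
  rw [isType, Term.sat_and, sat_not]
  refine and_congr (not_congr ?_) ?_
  · refine sat_exB (N := P.κ) (by omega) (fun i => (v1 i).κ) fun i hi => ?_
    simp [h.eval_cov (v1 i), hz, hi]
  · refine sat_allB (N := P.κ) (by omega) (fun i => (v1 i).κ) fun i hi => ?_
    have hi' : i < X := by omega
    simp [h.sat_bit, h.sat_adjG (v1 i), h.eval_cov (v1 i), hz, hi, hS, hi']

theorem eval_count (h : P.Stored X A) (hρ : P.Vars ρ) (hz : ρ 10 < X) (hS : ρ 16 < X) :
    Term.count.eval X A ρ = P.count (ρ 10) (ρ 16) := by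
  classical
  have h2 := h.base_le
  have h3 := h.n_lt
  have v1 := fun i : ℕ => hρ.update (v := i) (show 4 < 14 by norm_num)
  have key : ∀ v, (Term.and (.lt (.var 14) (.var 3)) .isType).eval X A (Function.update ρ 14 v) ≠ 0
      ↔ v < P.n ∧ P.IsType (ρ 10) (ρ 16) v := fun v => by
    rw [← Sat, Term.sat_and, h.sat_isType (v1 v) (by simpa using hz) (by simpa using hS)]
    simp [hρ.n]
  simp only [Term.count, eval, key, Inst.count]
  rw [← Finset.sum_filter, Finset.sum_const, smul_eq_mul, mul_one]
  congr 1
  ext v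
  simp only [Finset.mem_filter, Finset.mem_range]
  constructor
  · rintro ⟨-, h⟩
    exact h
  · exact fun h => ⟨by omega, h⟩

theorem sat_init (h : P.Stored X A) (hρ : P.Vars ρ) (hz : ρ 10 < X) :
    init.Sat X A ρ ↔ P.Init (ρ 10) := by
  have h0 := Nat.two_pow_pos P.κ
  have h1 := h.lt_size
  have v1 := fun i : ℕ => hρ.update (v := i) (show 4 < 16 by norm_num)
  rw [init, Term.sat_and]
  refine and_congr (by rw [sat_eq, h.eval_placed (a := .var 10) hρ hz]; simp) ?_
  refine sat_allB (N := 2 ^ P.κ) (by omega) (fun i => (v1 i).pow) fun S hS => ?_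
  have hS' : S < X := by omega
  simp [h.eval_digit (v1 S), hz, hS']

theorem sat_step (h : P.Stored X A) (hρ : P.Vars ρ) (hz : ρ 10 < X) (hz' : ρ 11 < X) :
    step.Sat X A ρ ↔ P.Step (ρ 11) (ρ 10) := by
  have h0 := Nat.two_pow_pos P.κ
  have h1 := h.lt_size
  have w1 := fun i : ℕ => hρ.update (v := i) (show 4 < 12 by norm_num)
  have v1 := fun i : ℕ => hρ.update (v := i) (show 4 < 16 by norm_num)
  have v2 := fun i j : ℕ => (v1 i).update (v := j) (show 4 < 17 by norm_num)
  rw [step, Term.sat_and, Term.sat_and]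
  refine and_congr (by rw [sat_eq, h.eval_placed (a := .var 10) hρ hz, eval_add, 
    h.eval_placed (a := .var 11) hρ hz']; simp) (and_congr ?_ ?_)
  · refine sat_allB (N := P.κ + P.κ) (by omega) (fun i => by simp [hρ.κ]) fun i hi => ?_
    have hi' : 2 ^ P.κ + 1 + i < X := by omega
    simp [cov, h.eval_digit (w1 i), hz, hz', hρ.pow, hi']
  · refine sat_allB (N := 2 ^ P.κ) (by omega) (fun i => (v1 i).pow) fun S hS => ?_
    have hS' : S < X := by omega
    rw [Term.sat_or, Term.sat_and, Term.sat_and]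
    refine or_congr ?_ (and_congr ?_ (and_congr ?_ ?_))
    · simp [h.eval_digit (v1 S), hz, hz', hS']
    · simp [h.eval_digit (v1 S), hz, hz', hS']
    · rw [h.sat_allowed (v1 S)] <;> simp [hz, hz', hS']
    · refine sat_allB (N := 2 ^ P.κ) (by omega) (fun i => (v2 S i).pow) fun S' hS'' => ?_
      have hS₂ : S' < X := by omega
      rw [sat_imp, sat_imp, h.sat_disj (v2 S S') (by simpa using hS') (by simpa using hS₂)]
      simp [h.eval_digit (v2 S S'), hz, hz', hS₂]

-- A predecessor is a smaller number, so the cells below the current one suffice; this is the form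
-- that `Term.fill_runs` requires.
open Classical in
theorem eval_reach (h : P.Stored X A) (hρ : P.Vars ρ) (hz : ρ 10 < X)
    (hA : ∀ z < ρ 10, A 3 z = if P.Reach z then 1 else 0) :
    Term.reach.eval X A ρ = if P.Reach (ρ 10) then 1 else 0 := by
  have v1 := fun i : ℕ => hρ.update (v := i) (show 4 < 11 by norm_num)
  have key : (Term.or .init (.exB 11 (.var 10) (.and (.get 3 (.var 11)) .step))).eval X A ρ ≠ 0 ↔
      P.Reach (ρ 10) := by
    rw [← Sat, Term.sat_or, h.sat_init hρ hz, P.reach_iff]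
    refine or_congr Iff.rfl (sat_exB hz.le (fun i => by simp) fun z' hz' => ?_)
    rw [Term.sat_and, h.sat_step (v1 z') (by simpa using hz) (by simpa using hz'.trans hz)]
    simp [Sat, hA z' hz']
  simp only [Term.reach, eval, key]

theorem sat_final (h : P.Stored X A) (hρ : P.Vars ρ) (hz : ρ 10 < X)
    (hA : A 3 (ρ 10) ≠ 0 ↔ P.Reach (ρ 10)) :
    final.Sat X A ρ ↔ P.Final (ρ 10) := by
  have h0 := Nat.two_pow_pos P.κ
  have h1 := h.lt_size
  have v1 := fun i : ℕ => hρ.update (v := i) (show 4 < 16 by norm_num)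
  rw [final, Term.sat_and, Term.sat_and, Term.sat_and, Term.sat_and, Term.sat_and,
    h.sat_covers (t := .var 0) hρ hz le_rfl fun ρ hρ => hρ.κ, h.sat_consistent hρ hz]
  refine and_congr Iff.rfl (and_congr Iff.rfl (and_congr ?_ (and_congr ?_ (and_congr ?_ ?_))))
  · rw [sat_eq, h.eval_placed (a := .var 10) hρ hz, eval_var, eval_var, hρ.m]
  · simp [hρ.n, hρ.m]
  · refine sat_allB (N := 2 ^ P.κ) (by omega) (fun i => (v1 i).pow) fun S hS => ?_
    have hS' : S < X := by omega
    rw [sat_imp, sat_eq, h.eval_count (v1 S) (by simpa using hz) (by simpa using hS')]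
    simp [h.eval_digit (v1 S), hz, hS', Sat]
  · simpa [Sat] using hA

end Inst.Stored

/-! ## Encodings -/

theorem matrixBits_length {n : ℕ} (R : Fin n → Fin n → Prop) :
    (matrixBits R).length = n * n := by
  simp [matrixBits]

theorem matrixBits_getElem? {n : ℕ} (R : Fin n → Fin n → Prop) (u v : Fin n) :
    (matrixBits R)[n * u.val + v.val]? = some true ↔ R u v := by
  classical
  have hn : 0 < n := u.pos
  have hlt : n * u.val + v.val < n * n := by
    have h1 := Nat.mul_le_mul_left n (Nat.succ_le_of_lt u.isLt)
    have := v.isLt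
    rw [Nat.mul_succ] at h1
    omega
  have hu : (⟨n * u.val + v.val, hlt⟩ : Fin (n * n)).divNat = u := by
    ext; simp [Fin.divNat, Nat.mul_add_div hn]
  have hv : (⟨n * u.val + v.val, hlt⟩ : Fin (n * n)).modNat = v := by
    ext; simp [Fin.modNat, Nat.mod_eq_of_lt v.isLt]
  simp [matrixBits, hlt, hu, hv]

section

variable {n m : ℕ} (G : SimpleGraph (Fin n)) (H : LoopGraph (Fin m))

theorem encode_length : (encode G H).length = n + m + 2 + n * n + m * m := by
  simp [encode, matrixBits_length]; omega

theorem encode_getElem?_guest {i : ℕ} (hi : i < n) : (encode G H)[i]? = some true := by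
  simp [encode, List.getElem?_append, hi]

theorem encode_getElem?_guest_end : (encode G H)[n]? = some false := by
  simp [encode]

theorem encode_getElem?_host {i : ℕ} (hi : i < m) :
    (encode G H)[n + 1 + i]? = some true := by
  simp [encode, List.getElem?_append, hi, show ¬ n + 1 + i < n by omega,
    show n + 1 + i - n = i + 1 by omega]

theorem encode_getElem?_host_end : (encode G H)[n + 1 + m]? = some false := by
  simp [encode, List.getElem?_append, show ¬ n + 1 + m < n by omega,
    show n + 1 + m - n = m + 1 by omega]

theorem encode_getElem?_matrix (k : ℕ) :
    (encode G H)[n + m + 2 + k]? = (matrixBits G.Adj ++ matrixBits H.Adj)[k]? := by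
  rw [encode, List.getElem?_append_right (by simp; omega)]
  congr 1
  simp; omega

theorem encode_getElem?_adj_guest (u v : Fin n) :
    (encode G H)[n + m + 2 + n * u.val + v.val]? = some true ↔ G.Adj u v := by
  have := Nat.mul_le_mul_left n (Nat.succ_le_of_lt u.isLt)
  rw [Nat.mul_succ] at this
  rw [add_assoc, encode_getElem?_matrix,
    List.getElem?_append_left (by rw [matrixBits_length]; omega), matrixBits_getElem?]

theorem encode_getElem?_adj_host (u v : Fin m) :
    (encode G H)[n + m + 2 + n * n + m * u.val + v.val]? = some true ↔ H.Adj u v := by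
  rw [add_assoc, add_assoc, encode_getElem?_matrix,
    List.getElem?_append_right (by rw [matrixBits_length]; omega), matrixBits_length,
    Nat.add_sub_cancel_left, matrixBits_getElem?]

end

theorem eq_of_runs {p : ℕ → Prop} {N N' : ℕ} (h : ∀ j < N, p j) (hN : ¬ p N)
    (h' : ∀ j < N', p j) (hN' : ¬ p N') : N = N' := by
  rcases lt_trichotomy N N' with hlt | rfl | hlt
  · exact absurd (h' _ hlt) hN
  · rfl
  · exact absurd (h _ hlt) hN'

/-- From position `off` on, the word `I` has exactly `N` ones before the first other entry. -/
def IsRun (I : List Bool) (off N : ℕ) : Prop :=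
  (∀ j < N, I[off + j]? = some true) ∧ ¬ I[off + N]? = some true

theorem exists_isRun (I : List Bool) (off : ℕ) : ∃ N ≤ I.length, IsRun I off N := by
  classical
  have h : ∃ N, ¬ I[off + N]? = some true := ⟨I.length, by simp⟩
  refine ⟨Nat.find h, Nat.find_min' h (by simp), fun j hj => ?_, Nat.find_spec h⟩
  simpa using Nat.find_min h hj

/-- The word `I` read as two graphs on `n` and `m` vertices. -/
def instOf (I : List Bool) (κ n m : ℕ) : Inst where
  κ := κ
  B := I.length + 2
  n := n
  m := m
  G u v := u < n ∧ v < n ∧ I[n + m + 2 + n * u + v]? = some true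
  H u v := u < m ∧ v < m ∧ I[n + m + 2 + n * n + m * u + v]? = some true

/-- The two matrices of the instance have the right size and belong to graphs. -/
structure Inst.Valid (P : Inst) (len : ℕ) : Prop where
  length : len = P.n + P.m + 2 + P.n * P.n + P.m * P.m
  irrefl_G : ∀ u < P.n, ¬ P.G u u
  symm_G : ∀ u < P.n, ∀ v < P.n, P.G u v → P.G v u
  symm_H : ∀ u < P.m, ∀ v < P.m, P.H u v → P.H v u

variable {I : List Bool} {κ n m : ℕ}

/-- The unary prefixes determine both numbers of vertices, so the numbers found in a word are the
only candidates for an encoding. -/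
theorem IsRun.encode (hn : IsRun I 0 n) (hm : IsRun I (n + 1) m) {n' m' : ℕ}
    (G : SimpleGraph (Fin n')) (H : LoopGraph (Fin m')) (h : I = encode G H) :
    n = n' ∧ m = m' := by
  have h1 : n = n' := eq_of_runs (p := fun j => I[0 + j]? = some true) hn.1 hn.2
    (fun j hj => by rw [h, zero_add]; exact encode_getElem?_guest G H hj)
    (by rw [h, zero_add, encode_getElem?_guest_end]; simp)
  subst h1
  exact ⟨rfl, eq_of_runs (p := fun j => I[n + 1 + j]? = some true) hm.1 hm.2
    (fun j hj => by rw [h]; exact encode_getElem?_host G H hj)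
    (by rw [h, encode_getElem?_host_end]; simp)⟩

/-- The graphs `G`, `H` are those of the instance. -/
structure Inst.Represents (P : Inst) {n m : ℕ} (G : SimpleGraph (Fin n)) (H : LoopGraph (Fin m)) :
    Prop where
  n_eq : P.n = n
  m_eq : P.m = m
  G_iff : ∀ u v, P.G u v ↔ ∃ hu hv, G.Adj ⟨u, hu⟩ ⟨v, hv⟩
  H_iff : ∀ u v, P.H u v ↔ ∃ hu hv, H.Adj ⟨u, hu⟩ ⟨v, hv⟩

theorem instOf_represents (G : SimpleGraph (Fin n)) (H : LoopGraph (Fin m))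
    (h : I = encode G H) : (instOf I κ n m).Represents G H := by
  subst h
  refine ⟨rfl, rfl, fun u v => ⟨fun ⟨hu, hv, h⟩ => ⟨hu, hv, ?_⟩, fun ⟨hu, hv, h⟩ => ⟨hu, hv, ?_⟩⟩,
    fun u v => ⟨fun ⟨hu, hv, h⟩ => ⟨hu, hv, ?_⟩, fun ⟨hu, hv, h⟩ => ⟨hu, hv, ?_⟩⟩⟩
  · exact (encode_getElem?_adj_guest G H ⟨u, hu⟩ ⟨v, hv⟩).1 h
  · exact (encode_getElem?_adj_guest G H ⟨u, hu⟩ ⟨v, hv⟩).2 h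
  · exact (encode_getElem?_adj_host G H ⟨u, hu⟩ ⟨v, hv⟩).1 h
  · exact (encode_getElem?_adj_host G H ⟨u, hu⟩ ⟨v, hv⟩).2 h

theorem Inst.Represents.valid {P : Inst} {G : SimpleGraph (Fin n)} {H : LoopGraph (Fin m)}
    (h : P.Represents G H) : P.Valid (n + m + 2 + n * n + m * m) := by
  obtain ⟨rfl, rfl, hG, hH⟩ := h
  refine ⟨rfl, fun u _ hu => ?_, fun u _ v _ huv => ?_, fun u _ v _ huv => ?_⟩
  · obtain ⟨_, _, h⟩ := (hG _ _).1 hu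
    exact G.loopless.irrefl _ h
  · obtain ⟨h1, h2, h⟩ := (hG _ _).1 huv
    exact (hG _ _).2 ⟨h2, h1, h.symm⟩
  · obtain ⟨h1, h2, h⟩ := (hH _ _).1 huv
    exact (hH _ _).2 ⟨h2, h1, H.symm _ _ h⟩

/-- The graphs are read off from the word, and their encoding is compared with it in each block: two
unary numbers, two end marks, two matrices. -/
theorem Inst.Valid.exists_encode (hn : IsRun I 0 n) (hm : IsRun I (n + 1) m)
    (h : (instOf I κ n m).Valid I.length) :
    ∃ (G : SimpleGraph (Fin n)) (H : LoopGraph (Fin m)), I = encode G H := by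
  have hlen := h.length
  simp only [instOf] at hlen
  obtain ⟨G, hG⟩ : ∃ G : SimpleGraph (Fin n), ∀ u v, G.Adj u v ↔ (instOf I κ n m).G u v :=
    ⟨{  Adj := fun u v => (instOf I κ n m).G u v
        symm := ⟨fun u v huv => h.symm_G u u.2 v v.2 huv⟩
        loopless := ⟨fun u hu => h.irrefl_G u u.2 hu⟩ }, fun _ _ => Iff.rfl⟩
  obtain ⟨H, hH⟩ : ∃ H : LoopGraph (Fin m), ∀ u v, H.Adj u v ↔ (instOf I κ n m).H u v :=
    ⟨{  Adj := fun u v => (instOf I κ n m).H u v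
        symm := fun u v huv => h.symm_H u u.2 v v.2 huv }, fun _ _ => Iff.rfl⟩
  -- Knowing where the ones stand is enough, since the lengths agree.
  have key : ∀ i < I.length, I[i]? = some true ↔ (encode G H)[i]? = some true := by
    intro i hi
    by_cases h1 : i < n
    · rw [encode_getElem?_guest G H h1, ← zero_add i, hn.1 i h1]
    by_cases h2 : i = n
    · subst h2
      have := hn.2
      rw [zero_add] at this
      rw [encode_getElem?_guest_end]
      simp [this]
    by_cases h3 : i < n + 1 + m
    · obtain ⟨j, rfl⟩ := Nat.exists_eq_add_of_le (show n + 1 ≤ i by omega)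
      rw [encode_getElem?_host G H (by omega), hm.1 j (by omega)]
    by_cases h4 : i = n + 1 + m
    · subst h4
      rw [encode_getElem?_host_end]
      simp [hm.2]
    by_cases h5 : i < n + m + 2 + n * n
    · obtain ⟨k, rfl⟩ := Nat.exists_eq_add_of_le (show n + m + 2 ≤ i by omega)
      have hk : k < n * n := by omega
      have hn0 : 0 < n := Nat.pos_of_ne_zero fun h => by simp [h] at hk
      have hu : k / n < n := Nat.div_lt_of_lt_mul hk
      have hv : k % n < n := Nat.mod_lt _ hn0
      have := encode_getElem?_adj_guest G H ⟨k / n, hu⟩ ⟨k % n, hv⟩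
      simp only [hG, instOf, hu, hv, true_and] at this
      rw [add_assoc, Nat.div_add_mod] at this
      exact this.symm
    · obtain ⟨k, rfl⟩ := Nat.exists_eq_add_of_le (show n + m + 2 + n * n ≤ i by omega)
      have hk : k < m * m := by omega
      have hn0 : 0 < m := Nat.pos_of_ne_zero fun h => by simp [h] at hk
      have hu : k / m < m := Nat.div_lt_of_lt_mul hk
      have hv : k % m < m := Nat.mod_lt _ hn0
      have := encode_getElem?_adj_host G H ⟨k / m, hu⟩ ⟨k % m, hv⟩
      simp only [hH, instOf, hu, hv, true_and] at this
      rw [add_assoc _ (m * _), Nat.div_add_mod] at this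
      exact this.symm
  have hl : I.length = (encode G H).length := by rw [encode_length, hlen]
  refine ⟨G, H, List.ext_getElem hl fun i h1 h2 => ?_⟩
  have := key i h1
  rw [List.getElem?_eq_getElem h1, List.getElem?_eq_getElem h2] at this
  exact Bool.eq_iff_iff.2 (by simpa using this)

/-! ### The vertex cover number and the meaning of certificates -/

/-- A minimum cover is listed and padded with `n`, which is no vertex; conversely `j` values name at
most `j` vertices. -/
theorem vertexCoverNum_le_iff_exists {n j : ℕ} (G : SimpleGraph (Fin n)) :
    G.vertexCoverNum ≤ j ↔ ∃ c : ℕ → ℕ, (∀ i, c i ≤ n) ∧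
      ∀ u v : Fin n, G.Adj u v → ∃ i < j, u.val = c i ∨ v.val = c i := by
  classical
  constructor
  · intro h
    obtain ⟨s, hs, hcov⟩ := G.vertexCoverNum_exists
    rw [← hs, Set.encard_eq_coe_toFinset_card, Nat.cast_le, ← Finset.length_toList] at h
    have hmem : ∀ u ∈ s, ∃ i < j, u.val = ((s.toFinset.toList.map Fin.val)[i]?).getD n := by
      intro u hu
      obtain ⟨i, hi, hiu⟩ := List.getElem_of_mem (Finset.mem_toList.2 (Set.mem_toFinset.2 hu))
      exact ⟨i, hi.trans_le h, by simp [List.getElem?_eq_getElem hi, hiu]⟩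
    refine ⟨fun i => ((s.toFinset.toList.map Fin.val)[i]?).getD n, fun i => ?_, fun u v huv => ?_⟩
    · dsimp only
      rw [List.getElem?_map]
      cases s.toFinset.toList[i]? with
      | none => simp
      | some u => simp
    · rcases hcov huv with hu | hv
      · obtain ⟨i, hi, h⟩ := hmem u hu
        exact ⟨i, hi, .inl h⟩
      · obtain ⟨i, hi, h⟩ := hmem v hv
        exact ⟨i, hi, .inr h⟩
  · rintro ⟨c, -, hc⟩
    have hcov : G.IsVertexCover {u | ∃ i < j, u.val = c i} := by
      intro u v huv
      obtain ⟨i, hi, h | h⟩ := hc u v huv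
      · exact .inl ⟨i, hi, h⟩
      · exact .inr ⟨i, hi, h⟩
    refine hcov.vertexCoverNum_le.trans ?_
    rw [← Function.Injective.encard_image Fin.val_injective]
    calc (Fin.val '' {u : Fin n | ∃ i < j, u.val = c i}).encard
        ≤ ((Finset.range j).image c : Set ℕ).encard := Set.encard_le_encard (by
          rintro _ ⟨u, ⟨i, hi, h⟩, rfl⟩
          simpa using ⟨i, hi, h.symm⟩)
      _ ≤ j := by
          rw [Set.encard_coe_eq_coe_finsetCard, Nat.cast_le]
          simpa using Finset.card_image_le (s := Finset.range j) (f := c)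

namespace Inst.Represents

variable {P : Inst} {n m : ℕ} {G : SimpleGraph (Fin n)} {H : LoopGraph (Fin m)}

theorem wellFormed (h : P.Represents G H) (hn : P.n < P.B) (hm : P.m < P.B) : P.WellFormed := by
  obtain ⟨rfl, rfl, hG, hH⟩ := h
  refine ⟨hn, hm, fun h => ?_, fun h => ?_, fun h => ?_⟩
  · exact ((hG _ _).1 h).1
  · obtain ⟨h1, h2, h⟩ := (hG _ _).1 h
    exact (hG _ _).2 ⟨h2, h1, h.symm⟩
  · obtain ⟨h1, h2, h⟩ := (hH _ _).1 h
    exact (hH _ _).2 ⟨h2, h1, H.symm _ _ h⟩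

theorem covers_iff (h : P.Represents G H) {j z : ℕ} :
    P.Covers j z ↔ ∀ u v : Fin n, G.Adj u v → ∃ i < j, u.val = P.C z i ∨ v.val = P.C z i := by
  obtain ⟨rfl, rfl, hG, hH⟩ := h
  constructor
  · exact fun hc u v huv => hc u u.2 v v.2 ((hG _ _).2 ⟨u.2, v.2, huv⟩)
  · exact fun hc u hu v hv huv => hc ⟨u, hu⟩ ⟨v, hv⟩ ((hG _ _).1 huv).2.2

theorem exists_covers_iff (h : P.Represents G H) (hn : P.n < P.B) {j : ℕ} (hj : j ≤ P.κ) :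
    (∃ z < P.B ^ numDigits P.κ, P.Covers j z) ↔ G.vertexCoverNum ≤ j := by
  have hB : 0 < P.B := (Nat.zero_le _).trans_lt hn
  rw [vertexCoverNum_le_iff_exists]
  constructor
  · rintro ⟨z, -, hz⟩
    -- Digits beyond `n` name no vertex and may be cut down to `n`.
    refine ⟨fun i => min (P.C z i) n, fun i => min_le_right _ _, fun u v huv => ?_⟩
    obtain ⟨i, hi, hc⟩ := h.covers_iff.1 hz u v huv
    have := u.2
    have := v.2
    exact ⟨i, hi, by dsimp only; omega⟩
  · rintro ⟨c, hc, hcov⟩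
    -- Only the digits of the cover matter. Elsewhere the formula, with its truncated subtraction,
    -- still gives values of `c`, which fit the base.
    obtain ⟨z, hz, hd⟩ := exists_dig hB (numDigits P.κ) (fun i => c (i - (2 ^ P.κ + 1)))
      fun i _ => (hc _).trans_lt (h.n_eq ▸ hn)
    refine ⟨z, hz, h.covers_iff.2 fun u v huv => ?_⟩
    obtain ⟨i, hi, hci⟩ := hcov u v huv
    refine ⟨i, hi, ?_⟩
    rwa [C, hd _ (by unfold numDigits; omega), Nat.add_sub_cancel_left]

theorem exists_final_iff (h : P.Represents G H) (hn : P.n < P.B) (hm : P.m < P.B) :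
    (∃ z < P.B ^ numDigits P.κ, P.Final z) ↔ G.vertexCoverNum ≤ P.κ ∧ HasLocInjHom G H := by
  have hP := h.wellFormed hn hm
  constructor
  · rintro ⟨z, hz, hf⟩
    refine ⟨(h.exists_covers_iff hn le_rfl).1 ⟨z, hz, hf.1⟩, ?_⟩
    obtain ⟨f, hf⟩ := hf.exists_isHom hP
    obtain ⟨rfl, rfl, hG, hH⟩ := h
    refine ⟨fun v => ⟨f v, hf.lt v v.2⟩, fun u v huv => ?_, fun u v hv v' hv' hff => ?_⟩
    · exact ((hH _ _).1 (hf.adj ((hG _ _).2 ⟨u.2, v.2, huv⟩))).2.2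
    · exact Fin.ext (hf.inj ((hG _ _).2 ⟨u.2, v.2, hv⟩) ((hG _ _).2 ⟨u.2, v'.2, hv'⟩)
        (Fin.ext_iff.1 hff))
  · rintro ⟨hvc, f, hadj, hinj⟩
    obtain ⟨c, hc, hcov⟩ := (vertexCoverNum_le_iff_exists G).1 hvc
    obtain ⟨rfl, rfl, hG, hH⟩ := h
    have hf : P.IsHom fun v => if hv : v < P.n then f ⟨v, hv⟩ else 0 := by
      refine ⟨fun v hv => by simp [hv], fun {u v} huv => ?_, fun {u v v'} hv hv' hff => ?_⟩
      · obtain ⟨h1, h2, h⟩ := (hG _ _).1 huv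
        simpa [h1, h2] using (hH _ _).2 ⟨Fin.isLt _, Fin.isLt _, hadj _ _ h⟩
      · obtain ⟨h1, h2, h⟩ := (hG _ _).1 hv
        obtain ⟨h1', h2', h'⟩ := (hG _ _).1 hv'
        simp only [h2, h2', dif_pos] at hff
        exact Fin.ext_iff.1 (hinj ⟨u, h1⟩ h h' (Fin.ext hff))
    refine hf.exists_final hP hc fun {u v} huv => ?_
    obtain ⟨h1, h2, h⟩ := (hG _ _).1 huv
    exact hcov _ _ h

end Inst.Represents

/-! ## The algorithm -/

namespace Term

/-- The number of ones in array `0` from position `off` on before the first zero. -/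
def run (off : Term) : Term :=
  .sum 6 (.ite (.all 7 (.imp (.lt (.var 7) (.add (.var 6) (.const 1)))
    (.get 0 (.add off (.var 7))))) (.const 1) (.const 0))

/-- Variable `1` holds the length plus `2`, hence `4` where the length formula has `2`. -/
def valid : Term :=
  .and (.eq (.var 1) (.add (.add (.add (.add (.var 3) (.var 4)) (.const 4))
    (.mul (.var 3) (.var 3))) (.mul (.var 4) (.var 4))))
  (.and (.allB 10 (.var 3) (.not (.adjG (.var 10) (.var 10))))
  (.and (.allB 10 (.var 3) (.allB 11 (.var 3) (.imp (.adjG (.var 10) (.var 11))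
    (.adjG (.var 11) (.var 10)))))
  (.allB 10 (.var 4) (.allB 11 (.var 4) (.imp (.adjH (.var 10) (.var 11))
    (.adjH (.var 11) (.var 10)))))))

/-- The input encodes a yes-instance with a vertex cover of size `κ`. -/
def atMost : Term := .and .valid (.sum 10 .final)

/-- In addition there is no smaller vertex cover. -/
def exact : Term :=
  .and .atMost (.or (.eq (.var 0) (.const 0))
    (.not (.sum 10 (.covers (.sub (.var 0) (.const 1))))))

end Term

/-- Fill the tables, then answer whether `t` holds. -/
def search (t : Term) : Prog :=
  .seq setup
  (.seq (Term.assign 64 3 (.run (.const 0)))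
  (.seq (Term.assign 64 4 (.run (.add (.var 3) (.const 1))))
  (.seq (Term.fill 64 1 5 .powTwo)
  (.seq (Term.fill 64 2 5 .powBase)
  (.seq (Term.fill 64 3 10 .reach)
  (.seq (Term.comp 64 (.ite t (.const 1) (.const 0)))
  (.assign 0 (.reg 64))))))))

/-- The positions `o` to `o + i` all carry ones exactly for `i < N`, so the sum counts to `N`. -/
theorem eval_run {I : List Bool} {X N : ℕ} {A : ℕ → ℕ → ℕ} {ρ : ℕ → ℕ} {off : Term} {o : ℕ}
    (hA : ∀ i, A 0 i ≠ 0 ↔ I[i]? = some true)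
    (ho : ∀ i j, off.eval X A (Function.update (Function.update ρ 6 i) 7 j) = o)
    (hN : IsRun I o N) (hX : N ≤ X) : (run off).eval X A ρ = N := by
  have key : ∀ i < X, ((Term.all 7 (.imp (.lt (.var 7) (.add (.var 6) (.const 1)))
      (.get 0 (.add off (.var 7))))).eval X A (Function.update ρ 6 i) ≠ 0 ↔ i < N) := by
    intro i hi
    change Sat _ _ _ _ ↔ _
    have h : ∀ j, Sat X A (.get 0 (.add off (.var 7)))
        (Function.update (Function.update ρ 6 i) 7 j) ↔ I[o + j]? = some true := fun j => by
      rw [← hA, Sat, eval_get, eval_add, ho]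
      simp
    simp only [sat_all, sat_imp, sat_lt, h]
    constructor
    · intro H
      by_contra hc
      exact hN.2 (H N (by omega) (by simp; omega))
    · exact fun H j hj hji => hN.1 j (by simp at hji; omega)
  simp only [run, eval]
  rw [Finset.sum_congr rfl (g := fun i => if i < N then 1 else 0)
    fun i hi => by simp only [key i (Finset.mem_range.1 hi)]]
  rw [← Finset.sum_filter, Finset.sum_const, smul_eq_mul, mul_one,
    show (Finset.range X).filter (fun i => i < N) = Finset.range N by ext; simp; omega,
    Finset.card_range]

theorem Inst.Stored.update {P : Inst} {X : ℕ} {A : ℕ → ℕ → ℕ} (h : P.Stored X A)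
    (row : ℕ → ℕ) : P.Stored X (Function.update A 3 row) :=
  ⟨h.size, h.two_le, h.n_lt, h.m_lt, by simpa using h.pow_two, by simpa using h.pow_base,
    by simpa using h.adj_G, by simpa using h.adj_H⟩

/-- A bound on the running time of `search t`, in terms of the size. -/
def searchTime (t : Term) (X : ℕ) : ℕ :=
  (30 + X * 12 + X * (X * 12 + 18)) +
  (((run (.const 0)).time X + 2) +
  (((run (.add (.var 3) (.const 1))).time X + 2) +
  ((2 + (X * (powTwo.time X + 3 + 8) + 4)) +
  ((2 + (X * (powBase.time X + 3 + 8) + 4)) +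
  ((2 + (X * (reach.time X + 3 + 8) + 4)) +
  ((Term.ite t (.const 1) (.const 0)).time X + 2))))))

/-- The machine run is settled here for any final test `t`; what remains in `hQ` is the meaning of
`t` over correct tables. -/
theorem search_answers {t : Term} (ht : t.bd ≤ 64) {I : List Bool} {κ n m : ℕ} {Q : Prop}
    (hn : IsRun I 0 n) (hnI : n ≤ I.length) (hm : IsRun I (n + 1) m) (hmI : m ≤ I.length)
    (hQ : ∀ X A ρ, (instOf I κ n m).Stored X A → (instOf I κ n m).Vars ρ →
      (∀ z < X, A 3 z ≠ 0 ↔ (instOf I κ n m).Reach z) → (t.Sat X A ρ ↔ Q)) :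
    Answers (search t) I κ (searchTime t ((I.length + 2) ^ numDigits κ)) Q := by
  classical
  set X := (I.length + 2) ^ numDigits κ with hX
  set P := instOf I κ n m with hP
  have hBX : I.length + 2 ≤ X := le_pow_numDigits _ _
  have hLX : numDigits κ ≤ X := (numDigits_lt_pow (by omega)).le
  have hκX : κ ≤ X := le_trans (by unfold numDigits; have := Nat.two_pow_pos κ; omega) hLX
  suffices h : Runs (search t) (initStore I κ) (searchTime t X)
      fun s => s.reg 0 = if Q then 1 else 0 by
    obtain ⟨T, s, he, hT, hs⟩ := h
    exact ⟨T, s, he, hT, fun h => by simp [hs, h], fun h => by simp [hs, h]⟩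
  refine Runs.seq ((setup_runs I κ).mono ?_ fun _ h => h) fun s ⟨h0, h1, h2, h3, hA⟩ => ?_
  · gcongr
  have hA0 : ∀ i, (initStore I κ).arr 0 i ≠ 0 ↔ I[i]? = some true := fun i => by
    simp [initStore]
  have hs : Holds 64 X (initStore I κ).arr (fun i => s.reg (i + 1)) s :=
    ⟨h0, fun _ _ => rfl, hA⟩
  generalize hρ : (fun i => s.reg (i + 1)) = ρ at hs
  have hρ0 : ρ 0 = κ := by rw [← hρ]; exact h1
  have hρ1 : ρ 1 = I.length + 2 := by rw [← hρ]; exact h2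
  have hρ2 : ρ 2 = 2 ^ κ := by rw [← hρ]; exact h3
  refine .seq (assign_runs (by decide +kernel) hs) fun s hs => ?_
  rw [eval_run hA0 (o := 0) (fun _ _ => rfl) hn (by omega)] at hs
  refine .seq (assign_runs (by decide +kernel) hs) fun s hs => ?_
  rw [eval_run hA0 (o := n + 1) (fun _ _ => by simp) hm (by omega)] at hs
  have hv : P.Vars (Function.update (Function.update ρ 3 n) 4 m) :=
    ⟨by simpa [hP, instOf] using hρ0, by simpa [hP, instOf] using hρ1,
      by simpa [hP, instOf] using hρ2, by simp [hP, instOf], by simp [hP, instOf]⟩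
  generalize Function.update (Function.update ρ 3 n) 4 m = ρ at hs hv
  refine .seq (fill_runs (by decide +kernel) (by norm_num) hs (fun i => 2 ^ i) ?_) ?_
  · intro i hi row hrow
    cases i with
    | zero => simp [powTwo, eval]
    | succ i => simp [powTwo, eval, hrow i, pow_succ, mul_two]
  rintro s ⟨row₁, hrow₁, hs⟩
  have hv := hv.update (v := X) (show 4 < 5 by norm_num)
  generalize Function.update ρ 5 X = ρ at hs hv
  refine .seq (fill_runs (by decide +kernel) (by norm_num) hs (fun i => (I.length + 2) ^ i) ?_) ?_
  · intro i hi row hrow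
    have hb : ρ 1 = I.length + 2 := hv.base
    cases i with
    | zero => simp [powBase, eval]
    | succ i =>
      simp only [powBase, eval]
      -- Only the factor `B` has to be at most `X`; the power may be larger.
      rw [eval_mul (by simpa [hb] using hBX)]
      simp [hb, hrow i, pow_succ, mul_comm]
  rintro s ⟨row₂, hrow₂, hs⟩
  have hv := hv.update (v := X) (show 4 < 5 by norm_num)
  generalize Function.update ρ 5 X = ρ at hs hv
  have hst : P.Stored X (Function.update (Function.update (initStore I κ).arr 1 row₁) 2 row₂) := by
    refine ⟨hX, by simp [hP, instOf], by simp [hP, instOf]; omega, by simp [hP, instOf]; omega,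
      by simpa using hrow₁, by simpa [hP, instOf] using hrow₂, fun u v => ?_, fun u v => ?_⟩
    · rw [Function.update_of_ne (by norm_num), Function.update_of_ne (by norm_num), hA0]
      rfl
    · rw [Function.update_of_ne (by norm_num), Function.update_of_ne (by norm_num), hA0]
      rfl
  generalize Function.update (Function.update (initStore I κ).arr 1 row₁) 2 row₂ = A at hs hst
  refine .seq (fill_runs (by decide +kernel) (by norm_num) hs (fun z => if P.Reach z then 1 else 0) ?_) ?_
  · intro z hz row hrow
    rw [(hst.update row).eval_reach (hv.update (by norm_num)) (by simpa using hz)]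
    · simp
    · simpa using hrow
  rintro s ⟨row₃, hrow₃, hs⟩
  have hv := hv.update (v := X) (show 4 < 10 by norm_num)
  have hst := hst.update row₃
  have hR : ∀ z < X, Function.update A 3 row₃ 3 z ≠ 0 ↔ P.Reach z := fun z hz => by
    simp [hrow₃ z hz]
  generalize Function.update ρ 10 X = ρ at hs hv
  generalize Function.update A 3 row₃ = A at hs hst hR
  have hb : (Term.ite t (.const 1) (.const 0)).bd ≤ 64 := by simp [Term.bd, ht]
  refine .seq (comp_runs _ hb (hs.mono hb)) fun s' ⟨_, h⟩ => .assign ?_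
  have := hQ X A ρ hst hv hR
  simp only [Sat] at this
  simp only [Store.setReg_reg, if_true, Expr.eval, h, eval, this]

/-! ### Running time in terms of the input length -/

theorem searchTime_polyBounded (t : Term) : PolyBounded (searchTime t) := by
  have T := time_polyBounded
  have F : ∀ t : Term, PolyBounded fun X => 2 + (X * (t.time X + 3 + 8) + 4) := fun t =>
    (PolyBounded.const 2).add
      ((PolyBounded.id.mul (((T t).add (.const 3)).add (.const 8))).add (.const 4))
  exact (((PolyBounded.const 30).add (PolyBounded.id.mul (.const 12))).add
    (PolyBounded.id.mul ((PolyBounded.id.mul (.const 12)).add (.const 18)))).add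
    (((T _).add (.const 2)).add (((T _).add (.const 2)).add ((F _).add ((F _).add ((F _).add
    ((T _).add (.const 2)))))))

theorem exists_searchTime_le (t : Term) :
    ∃ C D, ∀ B κ, 0 < B → searchTime t (B ^ numDigits κ) ≤ C * B ^ (numDigits κ * D) := by
  obtain ⟨C, D, h⟩ := searchTime_polyBounded t
  -- The factor `2 ^ D` comes from `x + 1 ≤ 2 * x` for positive `x`.
  refine ⟨C * 2 ^ D, D, fun B κ hB => (h _).trans ?_⟩
  have : 0 < B ^ numDigits κ := pow_pos hB _
  rw [mul_assoc, pow_mul, ← mul_pow]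
  gcongr
  omega

theorem numDigits_computable (D : ℕ) : Computable fun κ => numDigits κ * D := by
  have hpow : Primrec fun κ : ℕ => 2 ^ κ := by
    refine (Primrec.nat_rec₁ 1 (f := fun _ y => y + y)
      (Primrec.nat_add.comp Primrec.snd Primrec.snd)).of_eq fun n => ?_
    induction n with
    | zero => rfl
    | succ n ih => simp only [ih, pow_succ]; ring
  exact (Primrec.nat_mul.comp (Primrec.nat_add.comp (Primrec.succ.comp hpow)
    (Primrec.nat_add.comp Primrec.id Primrec.id)) (Primrec.const D)).to_comp

/-! ### Correctness of the two acceptance tests -/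

namespace Inst.Stored

variable {I : List Bool} {κ n m X : ℕ} {A : ℕ → ℕ → ℕ} {ρ : ℕ → ℕ}

theorem sat_valid (h : (instOf I κ n m).Stored X A) (hρ : (instOf I κ n m).Vars ρ) :
    valid.Sat X A ρ ↔ (instOf I κ n m).Valid I.length := by
  have h2 := h.base_le
  have h3 := h.n_lt
  have h4 := h.m_lt
  have v1 := fun i : ℕ => hρ.update (v := i) (show 4 < 10 by norm_num)
  have v2 := fun i j : ℕ => (v1 i).update (v := j) (show 4 < 11 by norm_num)
  have e1 : (Term.valid).Sat X A ρ ↔ (I.length = n + m + 2 + n * n + m * m ∧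
      (∀ u < n, ¬ (instOf I κ n m).G u u) ∧
      (∀ u < n, ∀ v < n, (instOf I κ n m).G u v → (instOf I κ n m).G v u) ∧
      (∀ u < m, ∀ v < m, (instOf I κ n m).H u v → (instOf I κ n m).H v u)) := by
    rw [valid, Term.sat_and, Term.sat_and, Term.sat_and]
    refine and_congr ?_ (and_congr ?_ (and_congr ?_ ?_))
    · rw [sat_eq, eval_add, eval_add, eval_mul, eval_mul]
      · simp [hρ.base, hρ.n, hρ.m, instOf]
        omega
      · simp [hρ.m]; omega
      · simp [hρ.n]; omega
    · refine sat_allB (N := n) (h3.le.trans h2) (fun i => (v1 i).n) fun u _ => ?_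
      simp [h.sat_adjG (v1 u)]
    · refine sat_allB (N := n) (h3.le.trans h2) (fun i => (v1 i).n) fun u _ =>
        sat_allB (N := n) (h3.le.trans h2) (fun i => (v2 u i).n) fun v _ => ?_
      simp [h.sat_adjG (v2 u v)]
    · refine sat_allB (N := m) (h4.le.trans h2) (fun i => (v1 i).m) fun u _ =>
        sat_allB (N := m) (h4.le.trans h2) (fun i => (v2 u i).m) fun v _ => ?_
      simp [h.sat_adjH (v2 u v)]
  exact e1.trans ⟨fun ⟨a, b, c, d⟩ => ⟨a, b, c, d⟩, fun ⟨a, b, c, d⟩ => ⟨a, b, c, d⟩⟩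

theorem sat_atMost (hn : IsRun I 0 n) (hm : IsRun I (n + 1) m)
    (h : (instOf I κ n m).Stored X A) (hρ : (instOf I κ n m).Vars ρ)
    (hR : ∀ z < X, A 3 z ≠ 0 ↔ (instOf I κ n m).Reach z) :
    atMost.Sat X A ρ ↔ ∃ (G : SimpleGraph (Fin n)) (H : LoopGraph (Fin m)),
      I = encode G H ∧ G.vertexCoverNum ≤ κ ∧ HasLocInjHom G H := by
  have v1 := fun i : ℕ => hρ.update (v := i) (show 4 < 10 by norm_num)
  have key : (Term.sum 10 .final).Sat X A ρ ↔ ∃ z < X, (instOf I κ n m).Final z := by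
    rw [sat_sum]
    refine exists_congr fun z => and_congr_right fun hz => ?_
    rw [h.sat_final (v1 z) (by simpa using hz) (by simpa using hR z hz)]
    simp
  rw [atMost, Term.sat_and, h.sat_valid hρ, key, h.size]
  constructor
  · rintro ⟨hv, hz⟩
    obtain ⟨G, H, hI⟩ := hv.exists_encode hn hm
    exact ⟨G, H, hI, ((instOf_represents G H hI).exists_final_iff h.n_lt h.m_lt).1 hz⟩
  · rintro ⟨G, H, hI, hGH⟩
    have hr := instOf_represents (κ := κ) G H hI
    refine ⟨?_, (hr.exists_final_iff h.n_lt h.m_lt).2 hGH⟩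
    rw [hI, encode_length, ← hI]
    exact hr.valid

theorem sat_exact (hn : IsRun I 0 n) (hm : IsRun I (n + 1) m)
    (h : (instOf I κ n m).Stored X A) (hρ : (instOf I κ n m).Vars ρ)
    (hR : ∀ z < X, A 3 z ≠ 0 ↔ (instOf I κ n m).Reach z) :
    Term.exact.Sat X A ρ ↔ ∃ (G : SimpleGraph (Fin n)) (H : LoopGraph (Fin m)),
      I = encode G H ∧ G.vertexCoverNum = κ ∧ HasLocInjHom G H := by
  have v1 := fun i : ℕ => hρ.update (v := i) (show 4 < 10 by norm_num)
  have key : (Term.sum 10 (.covers (.sub (.var 0) (.const 1)))).Sat X A ρ ↔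
      ∃ z < X, (instOf I κ n m).Covers (κ - 1) z := by
    rw [sat_sum]
    refine exists_congr fun z => and_congr_right fun hz => ?_
    rw [h.sat_covers (v1 z) (by simpa using hz) (Nat.sub_le κ 1) fun ρ hρ => by
      simp [hρ.κ, instOf]]
    simp
  have h0 : (Term.eq (.var 0) (.const 0)).Sat X A ρ ↔ κ = 0 := by
    simp [hρ.κ, instOf]
  rw [Term.exact, Term.sat_and, h.sat_atMost hn hm hρ hR, Term.sat_or, h0, sat_not, key, h.size]
  -- Being equal to `κ` means being at most `κ` and not at most `κ - 1`. The case `κ = 0` is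
  -- separate because the subtraction is truncated.
  have hvc : ∀ (G : SimpleGraph (Fin n)) (H : LoopGraph (Fin m)), I = encode G H →
      ((G.vertexCoverNum ≤ κ ∧ (κ = 0 ∨ ¬ ∃ z < (instOf I κ n m).B ^ numDigits
        (instOf I κ n m).κ, (instOf I κ n m).Covers (κ - 1) z)) ↔ G.vertexCoverNum = κ) := by
    intro G H hI
    rw [(instOf_represents G H hI).exists_covers_iff h.n_lt (Nat.sub_le κ 1)]
    obtain ⟨c, hc⟩ := ENat.ne_top_iff_exists.1 G.vertexCoverNum_ne_top_of_finite
    rw [← hc]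
    norm_cast
    omega
  constructor
  · rintro ⟨⟨G, H, hI, hG, hf⟩, h'⟩
    exact ⟨G, H, hI, (hvc G H hI).1 ⟨hG, h'⟩, hf⟩
  · rintro ⟨G, H, hI, hG, hf⟩
    obtain ⟨hG, h'⟩ := (hvc G H hI).2 hG
    exact ⟨⟨G, H, hI, hG, hf⟩, h'⟩

end Inst.Stored

/-! ### The two algorithms -/

theorem search_atMost (I : List Bool) (κ : ℕ) :
    Answers (search atMost) I κ (searchTime atMost ((I.length + 2) ^ numDigits κ))
      (I ∈ lihomVCAtMost κ) := by
  obtain ⟨n, hnI, hn⟩ := exists_isRun I 0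
  obtain ⟨m, hmI, hm⟩ := exists_isRun I (n + 1)
  refine search_answers (by decide +kernel) hn hnI hm hmI fun X A ρ h hρ hR => ?_
  rw [h.sat_atMost hn hm hρ hR]
  constructor
  · rintro ⟨G, H, h⟩
    exact ⟨n, m, G, H, h⟩
  · rintro ⟨n', m', G, H, hI, h⟩
    obtain ⟨rfl, rfl⟩ := hn.encode hm G H hI
    exact ⟨G, H, hI, h⟩

theorem search_exact (I : List Bool) (κ : ℕ) :
    Answers (search Term.exact) I κ (searchTime Term.exact ((I.length + 2) ^ numDigits κ))
      ((I, κ) ∈ lihomByVC) := by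
  obtain ⟨n, hnI, hn⟩ := exists_isRun I 0
  obtain ⟨m, hmI, hm⟩ := exists_isRun I (n + 1)
  refine search_answers (by decide +kernel) hn hnI hm hmI fun X A ρ h hρ hR => ?_
  rw [h.sat_exact hn hm hρ hR]
  constructor
  · rintro ⟨G, H, h⟩
    exact ⟨n, m, G, H, h⟩
  · rintro ⟨n', m', G, H, hI, h⟩
    obtain ⟨rfl, rfl⟩ := hn.encode hm G H hI
    exact ⟨G, H, hI, h⟩

/-- Without a parameter in the input, the constant `k` is written into register `1`, and the search
then starts as on parameter `k`. -/
theorem initStore_setReg (I : List Bool) (k : ℕ) :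
    (initStore I 0).setReg 1 k = initStore I k := by
  simp only [initStore, Store.setReg, Store.mk.injEq, and_true]
  funext r
  by_cases h : r = 1 <;> simp [h]

theorem lihomByVC_inXP : InXP lihomByVC := by
  obtain ⟨C, D, h⟩ := exists_searchTime_le Term.exact
  refine ⟨search Term.exact, fun κ => numDigits κ * D, C, numDigits_computable D, fun I κ => ?_⟩
  obtain ⟨t, s, he, ht, hs⟩ := search_exact I κ
  exact ⟨t, s, he, ht.trans (h _ _ (by omega)), hs⟩

theorem lihomVCAtMost_inP (k : ℕ) : InP (lihomVCAtMost k) := by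
  obtain ⟨C, D, h⟩ := exists_searchTime_le atMost
  refine ⟨.seq (.assign 1 (.const k)) (search atMost),
    -- The summand `2` pays for writing `k`; the exponent is constant since `k` is.
    2 + Polynomial.C C * (Polynomial.X + 2) ^ (numDigits k * D), fun I => ?_⟩
  obtain ⟨t, s, he, ht, hs⟩ := search_atMost I k
  rw [← initStore_setReg] at he
  refine ⟨_, s, (Exec.assign 1 (.const k) _).seq he, ?_, hs⟩
  have := ht.trans (h _ _ (by omega))
  simp [Expr.cost]
  omega

end LIHom

theorem mainTheorem4 :
    LIHom.InXP LIHom.lihomByVC ∧ ∀ k : ℕ, LIHom.InP (LIHom.lihomVCAtMost k) :=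
  ⟨LIHom.lihomByVC_inXP, LIHom.lihomVCAtMost_inP⟩
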